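/- Let $\Omega$ be a Polish space, $m\neq 0$ a finite Borel measure on $\Omega$, $\theta:\Omega\to\Omega$ a Borel map, and $\alpha=\{a_i \mid i\in I\}$ a finite partition of $\Omega$ into non-empty Borel sets. Assume that $(\Omega,m,\theta,\alpha)$ is a Markov fibred system, that is: * for each $i\in I$, $\theta$ is injective on $a_i$ and non-singular there in both directions: $m(\theta(E))=0 \iff m(E)=0$ for every Borel set $E\subseteq a_i$; * for each $i\in I$, $\theta(a_i)$ belongs to the $\sigma$-algebra generated by $\alpha$; * the $\sigma$-algebra generated by all the partitions $\theta^{-k}(\alpha)$, $k\ge 0$, coincides with the Borel $\sigma$-algebra up to sets of $m$-measure zero. Let $m\circ\theta$ be the measure $E\mapsto\sum_{i\in I} m(\theta(E\cap a_i))$, and assume that the Radon–Nikodym derivative $\frac{dm\circ\theta}{dm}$ has a version that is continuous on the support of $m$. Let $A=(a_{ij})_{i,j\in I}$ be the incidence matrix: $a_{ij}=1$ if $a_j\subseteq\theta(a_i)$, and $a_{ij}=0$ otherwise. Assume that $A$ is irreducible and is not a permutation matrix. Let $\mathcal O_A$ be the Cuntz–Krieger algebra of $A$, i.e. the universal unital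 $C^*$-algebra generated by partial isometries $S_i$ ($i\in I$) subject to $$\sum_{j\in I}S_jS_j^*=1,\qquad S_i^*S_i=\sum_{j\in I}a_{ij}S_jS_j^*\quad(i\in I).$$ Then for each $i\in I$ the formula $$s_i f=\mathbf 1_{a_i}\cdot\Big(\frac{dm\circ\theta}{dm}\Big)^{1/2}\cdot f\circ\theta$$ defines a bounded operator $s_i$ on $L^2(\Omega,m)$ (with complex scalars), and the Radon–Nikodym representation $\mathcal R_A(m)$, i.e. the $C^*$-algebra of operators on $L^2(\Omega,m)$ generated by $\{s_i \mid i\in I\}$, is $*$-isomorphic to $\mathcal O_A$, by a $*$-isomorphism that maps $S_i$ to $s_i$ for every $i\in I$. -/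

import Mathlib

open MeasureTheory
open scoped ENNReal NNReal

noncomputable section

/-! ### Cuntz–Krieger families and the Cuntz–Krieger algebra -/

/-- A Cuntz–Krieger family for the matrix `A` in a unital `*`-algebra: a family of partial
isometries `T i` with `∑ j, T j (T j)* = 1` and `(T i)* T i = ∑ j, A i j • T j (T j)*`. -/
structure IsCuntzKriegerFamily {I B : Type*} [Fintype I] [Ring B] [StarRing B]
    (A : Matrix I I ℤ) (T : I → B) : Prop where
  partial_isometry : ∀ i, T i * star (T i) * T i = T i
  sum_range : ∑ j, T j * star (T j) = 1
  source : ∀ i, star (T i) * T i = ∑ j, A i j • (T j * star (T j))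

/-- A partial isometry in a `C*`-algebra has norm at most one. -/
theorem norm_le_one_of_partial_isometry {B : Type*} [NormedRing B] [StarRing B] [CStarRing B]
    (v : B) (hv : v * star v * v = v) : ‖v‖ ≤ 1 := by
  have h1 : ‖star v * v‖ = ‖v‖ * ‖v‖ := CStarRing.norm_star_mul_self
  have h2 : ‖star (star v * v) * (star v * v)‖ = ‖star v * v‖ * ‖star v * v‖ :=
    CStarRing.norm_star_mul_self
  have h3 : star (star v * v) * (star v * v) = star v * v := by
    rw [star_mul, star_star, mul_assoc, ← mul_assoc v, hv]
  rw [h3, h1] at h2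
  by_contra! h
  have h4 : 1 < ‖v‖ * ‖v‖ := by
    calc (1 : ℝ) = 1 * 1 := (one_mul 1).symm
      _ < ‖v‖ * ‖v‖ := mul_lt_mul'' h h zero_le_one zero_le_one
  have h5 := mul_lt_mul_of_pos_left h4 (zero_lt_one.trans h4)
  linarith

section Universal

variable {I : Type*} [Fintype I] (H : Type*) [NormedAddCommGroup H] [InnerProductSpace ℂ H]
  [CompleteSpace H] (A : Matrix I I ℤ)

/-- All Cuntz–Krieger families for `A` in the bounded operators on the Hilbert space `H`. -/
abbrev CKRep : Type _ := {T : I → (H →L[ℂ] H) // IsCuntzKriegerFamily A T}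

/-- The `C*`-algebra of bounded continuous maps `T ↦ f T` from the set of all Cuntz–Krieger
families for `A` on `H` (with the topology of norm convergence of each `T i`) to the bounded
operators on `H`, with pointwise operations and the supremum norm. -/
abbrev CKProduct : Type _ := BoundedContinuousFunction (CKRep H A) (H →L[ℂ] H)

/-- The generators `ckGenerator H A i : T ↦ T i`. -/
def ckGenerator (i : I) : CKProduct H A :=
  BoundedContinuousFunction.ofNormedAddCommGroup (fun T => T.1 i)
    ((continuous_apply i).comp continuous_subtype_val) 1
    fun T => norm_le_one_of_partial_isometry _ (T.2.partial_isometry i)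

@[simp] theorem ckGenerator_apply (i : I) (T : CKRep H A) : ckGenerator H A i T = T.1 i := rfl

/-- The generators form a Cuntz–Krieger family. -/
theorem isCuntzKriegerFamily_ckGenerator : IsCuntzKriegerFamily A (ckGenerator H A) where
  partial_isometry i := by
    ext1 T
    exact T.2.partial_isometry i
  sum_range := by
    ext1 T
    simpa using T.2.sum_range
  source i := by
    ext1 T
    simpa using T.2.source i

/-- The `C*`-algebra generated by the universal Cuntz–Krieger family over `H`, that is, the
completion of the `*`-polynomials in the generators in the norm
`‖p‖ = sup {‖p(T)‖ | T a Cuntz–Krieger family for A on H}`. -/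
def ckAlgebra : StarSubalgebra ℂ (CKProduct H A) :=
  (StarAlgebra.adjoin ℂ (Set.range (ckGenerator H A))).topologicalClosure

theorem ckGenerator_mem (i : I) : ckGenerator H A i ∈ ckAlgebra H A :=
  StarSubalgebra.le_topologicalClosure _ (StarAlgebra.subset_adjoin ℂ _ ⟨i, rfl⟩)

end Universal

/-- The Cuntz–Krieger algebra `𝒪_A`: the universal `C*`-algebra generated by a Cuntz–Krieger
family for `A`. It is realized as the `C*`-algebra generated by the universal family over the
separable infinite-dimensional Hilbert space `ℓ²(ℕ)`. (Since `A` is finite, a `C*`-algebra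
generated by a Cuntz–Krieger family is separable, so that it embeds unitally in the bounded
operators on `ℓ²(ℕ)` unless it is zero; hence families in other `C*`-algebras do not enlarge the
supremum that defines the norm.) -/
abbrev CuntzKriegerAlgebra {I : Type*} [Fintype I] (A : Matrix I I ℤ) :
    StarSubalgebra ℂ (CKProduct (lp (fun _ : ℕ => ℂ) 2) A) :=
  ckAlgebra (lp (fun _ : ℕ => ℂ) 2) A

/-- The canonical generators `S i` of `𝒪_A`. -/
def CuntzKriegerAlgebra.S {I : Type*} [Fintype I] (A : Matrix I I ℤ) (i : I) :
    CuntzKriegerAlgebra A :=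
  ⟨ckGenerator _ A i, ckGenerator_mem _ A i⟩

/-! ### Markov fibred systems -/

/-- A Markov fibred system `(Ω, m, θ, α)` with partition `α = {a i | i ∈ I}`; it is used for a
Polish space `Ω` with its Borel `σ`-algebra, a finite measure `m` and a countable set `I`. -/
structure MarkovFibredSystem (Ω : Type*) [MeasurableSpace Ω] (m : Measure Ω) (I : Type*) where
  /-- the transformation -/
  θ : Ω → Ω
  /-- the atoms of the partition -/
  a : I → Set Ω
  measurable_θ : Measurable θ
  measurableSet_a : ∀ i, MeasurableSet (a i)
  nonempty_a : ∀ i, (a i).Nonempty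
  disjoint_a : Pairwise (Function.onFun Disjoint a)
  iUnion_a : ⋃ i, a i = Set.univ
  /-- `θ : a i → θ (a i)` is invertible … -/
  injOn_θ : ∀ i, Set.InjOn θ (a i)
  /-- … and non-singular, in both directions. -/
  nonsingular : ∀ i E, MeasurableSet E → E ⊆ a i → (m (θ '' E) = 0 ↔ m E = 0)
  /-- `θ (a i)` belongs to the `σ`-algebra generated by the partition. -/
  markov : ∀ i, MeasurableSet[MeasurableSpace.generateFrom (Set.range a)] (θ '' a i)
  /-- The `σ`-algebra generated by all the partitions `θ⁻ᵏ α` is, up to null sets, the whole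
  `σ`-algebra. -/
  generating : ∀ E, MeasurableSet E → ∃ F, MeasurableSet[⨆ k : ℕ,
    (MeasurableSpace.generateFrom (Set.range a)).comap (θ^[k])] F ∧ E =ᵐ[m] F

namespace MarkovFibredSystem

variable {Ω : Type*} [MeasurableSpace Ω] {m : Measure Ω} {I : Type*}

open Classical in
/-- The incidence matrix: `A i j = 1` if `a j ⊆ θ (a i)`, and `A i j = 0` otherwise (in which case
`a j` and `θ (a i)` are disjoint). -/
def incidence (X : MarkovFibredSystem Ω m I) : Matrix I I ℤ :=
  fun i j => if X.a j ⊆ X.θ '' X.a i then 1 else 0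

/-- The measure `m ∘ θ`, obtained by glueing the measures `E ↦ m (θ (E ∩ a i))`;
see `imageMeasure_apply`. -/
def imageMeasure (X : MarkovFibredSystem Ω m I) : Measure Ω :=
  Measure.sum fun i => (m.comap ((X.a i).domRestrict X.θ)).map Subtype.val

/-- The Radon–Nikodym derivative `dm∘θ/dm`. -/
def density (X : MarkovFibredSystem Ω m I) : Ω → ℝ≥0∞ := X.imageMeasure.rnDeriv m

/-- The Radon–Nikodym derivative `dm∘θ/dm` has a version that is continuous on the support
of `m`. -/
def HasContinuousDensity [TopologicalSpace Ω] (X : MarkovFibredSystem Ω m I) : Prop :=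
  ∃ h : Ω → ℝ, ContinuousOn h m.support ∧ ∀ᵐ x ∂m, (X.density x).toReal = h x

/-- The function `1_{a i} (dm∘θ/dm)^{1/2} f∘θ`. -/
def rnFun (X : MarkovFibredSystem Ω m I) (i : I) (f : Ω → ℂ) : Ω → ℂ :=
  (X.a i).indicator fun x => (√(X.density x).toReal : ℂ) * f (X.θ x)

theorem quasi (X : MarkovFibredSystem Ω m I) [Countable I] :
    Measure.QuasiMeasurePreserving X.θ m m := by
  refine ⟨X.measurable_θ, Measure.AbsolutelyContinuous.mk fun E hE h0 => ?_⟩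
  rw [Measure.map_apply X.measurable_θ hE]
  have h1 : X.θ ⁻¹' E = ⋃ i, X.θ ⁻¹' E ∩ X.a i := by
    rw [← Set.inter_iUnion, X.iUnion_a, Set.inter_univ]
  rw [h1, measure_iUnion_null_iff]
  intro i
  refine (X.nonsingular i _ ((X.measurable_θ hE).inter (X.measurableSet_a i))
    Set.inter_subset_right).1 (measure_mono_null ?_ h0)
  rintro _ ⟨x, hx, rfl⟩
  exact hx.1

theorem aestronglyMeasurable_rnFun (X : MarkovFibredSystem Ω m I) [Countable I] (i : I)
    {f : Ω → ℂ} (hf : AEStronglyMeasurable f m) : AEStronglyMeasurable (X.rnFun i f) m := by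
  refine AEStronglyMeasurable.indicator (AEStronglyMeasurable.mul ?_
    (hf.comp_quasiMeasurePreserving X.quasi)) (X.measurableSet_a i)
  have hdm : Measurable X.density := Measure.measurable_rnDeriv _ _
  exact (Complex.measurable_ofReal.comp hdm.ennreal_toReal.sqrt).aestronglyMeasurable

section Polish

variable [TopologicalSpace Ω] [PolishSpace Ω] [BorelSpace Ω]

theorem measurableEmbedding_restrict (X : MarkovFibredSystem Ω m I) (i : I) :
    MeasurableEmbedding ((X.a i).domRestrict X.θ) := by
  have := (X.measurableSet_a i).standardBorel
  exact (X.measurable_θ.comp measurable_subtype_coe).measurableEmbedding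
    (Set.injOn_iff_injective.1 (X.injOn_θ i))

/-- `(m ∘ θ)(E) = ∑ i, m (θ (E ∩ a i))`. -/
theorem imageMeasure_apply (X : MarkovFibredSystem Ω m I) {E : Set Ω} (hE : MeasurableSet E) :
    X.imageMeasure E = ∑' i, m (X.θ '' (E ∩ X.a i)) := by
  rw [imageMeasure, Measure.sum_apply _ hE]
  refine tsum_congr fun i => ?_
  rw [Measure.map_apply measurable_subtype_coe hE, (X.measurableEmbedding_restrict i).comap_apply]
  congr 1
  ext y
  simp only [Set.mem_image, Set.mem_preimage, Subtype.exists, Set.domRestrict_apply, Set.mem_inter_iff]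
  exact ⟨fun ⟨x, hx, h, e⟩ => ⟨x, ⟨h, hx⟩, e⟩, fun ⟨x, ⟨h, hx⟩, e⟩ => ⟨x, hx, h, e⟩⟩

theorem imageMeasure_absolutelyContinuous (X : MarkovFibredSystem Ω m I) :
    X.imageMeasure ≪ m := by
  refine Measure.AbsolutelyContinuous.mk fun E hE h0 => ?_
  rw [X.imageMeasure_apply hE, ENNReal.tsum_eq_zero]
  exact fun i => (X.nonsingular i _ (hE.inter (X.measurableSet_a i)) Set.inter_subset_right).2
    (measure_mono_null Set.inter_subset_left h0)

variable [IsFiniteMeasure m]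

/-- Change of variables on one atom. -/
theorem lintegral_atom_le (X : MarkovFibredSystem Ω m I) [Countable I] (i : I) (g : Ω → ℝ≥0∞)
    (hg : Measurable g) :
    ∫⁻ x in X.a i, X.density x * g (X.θ x) ∂m ≤ ∫⁻ y, g y ∂m := by
  have hf : ∀ j, IsFiniteMeasure (m.comap ((X.a j).domRestrict X.θ)) := fun j =>
    ⟨by rw [(X.measurableEmbedding_restrict j).comap_apply]; exact measure_lt_top _ _⟩
  have hs : SFinite X.imageMeasure := by unfold imageMeasure; infer_instance
  have hd : m.withDensity X.density = X.imageMeasure :=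
    Measure.withDensity_rnDeriv_eq _ _ X.imageMeasure_absolutelyContinuous
  have hdm : Measurable X.density := Measure.measurable_rnDeriv _ _
  have hgm := hg.comp X.measurable_θ
  have h1 : ∫⁻ x in X.a i, X.density x * g (X.θ x) ∂m
      = ∫⁻ x in X.a i, g (X.θ x) ∂X.imageMeasure := by
    rw [← hd, restrict_withDensity (X.measurableSet_a i),
      lintegral_withDensity_eq_lintegral_mul (g := fun x => g (X.θ x)) _ hdm hgm]
    rfl
  have h2 : X.imageMeasure.restrict (X.a i)
      = (m.comap ((X.a i).domRestrict X.θ)).map Subtype.val := by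
    ext E hE
    rw [Measure.restrict_apply hE, X.imageMeasure_apply (hE.inter (X.measurableSet_a i)),
      tsum_eq_single i, Measure.map_apply measurable_subtype_coe hE,
      (X.measurableEmbedding_restrict i).comap_apply]
    · congr 1
      ext y
      simp only [Set.mem_image, Set.mem_preimage, Subtype.exists, Set.domRestrict_apply,
        Set.mem_inter_iff]
      exact ⟨fun ⟨x, ⟨⟨h, _⟩, hx⟩, e⟩ => ⟨x, hx, h, e⟩,
        fun ⟨x, hx, h, e⟩ => ⟨x, ⟨⟨h, hx⟩, hx⟩, e⟩⟩
    · intro j hj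
      rw [Set.inter_assoc, (X.disjoint_a hj.symm).inter_eq]
      simp
  rw [h1, h2, lintegral_map (f := fun x => g (X.θ x)) hgm measurable_subtype_coe]
  calc ∫⁻ x : X.a i, g ((X.a i).domRestrict X.θ x) ∂m.comap ((X.a i).domRestrict X.θ)
      = ∫⁻ y, g y ∂(m.comap ((X.a i).domRestrict X.θ)).map ((X.a i).domRestrict X.θ) :=
        ((X.measurableEmbedding_restrict i).lintegral_map _).symm
    _ ≤ ∫⁻ y, g y ∂m := by
        rw [(X.measurableEmbedding_restrict i).map_comap]
        exact setLIntegral_le_lintegral _ _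

theorem eLpNorm_rnFun_le (X : MarkovFibredSystem Ω m I) [Countable I] (i : I)
    {f : Ω → ℂ} (hf : AEStronglyMeasurable f m) :
    eLpNorm (X.rnFun i f) 2 m ≤ eLpNorm f 2 m := by
  obtain ⟨g, hg, hfg⟩ := hf
  have h1 : X.rnFun i f =ᵐ[m] X.rnFun i g := by
    filter_upwards [X.quasi.ae_eq_comp hfg] with x hx
    have hx' : f (X.θ x) = g (X.θ x) := hx
    simp only [rnFun, Set.indicator, hx']
  rw [eLpNorm_congr_ae h1, eLpNorm_congr_ae hfg,
    eLpNorm_eq_lintegral_rpow_enorm_toReal two_ne_zero ENNReal.ofNat_ne_top,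
    eLpNorm_eq_lintegral_rpow_enorm_toReal two_ne_zero ENNReal.ofNat_ne_top]
  refine ENNReal.rpow_le_rpow ?_ (by positivity)
  refine le_trans ?_ (X.lintegral_atom_le i _ (hg.measurable.enorm.pow_const _))
  rw [← lintegral_indicator (X.measurableSet_a i)]
  refine lintegral_mono fun x => ?_
  by_cases hx : x ∈ X.a i
  · simp only [rnFun, Set.indicator_of_mem hx, ENNReal.toReal_ofNat, enorm_mul]
    rw [ENNReal.mul_rpow_of_nonneg _ _ (by norm_num)]
    gcongr
    rw [← ofReal_norm, Complex.norm_real, Real.norm_of_nonneg (Real.sqrt_nonneg _),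
      ENNReal.ofReal_rpow_of_nonneg (Real.sqrt_nonneg _) (by norm_num), Real.rpow_two,
      Real.sq_sqrt ENNReal.toReal_nonneg]
    exact ENNReal.ofReal_toReal_le
  · simp [rnFun, Set.indicator_of_notMem hx]

theorem memLp_rnFun (X : MarkovFibredSystem Ω m I) [Countable I] (i : I) (f : Lp ℂ 2 m) :
    MemLp (X.rnFun i f) 2 m :=
  ⟨X.aestronglyMeasurable_rnFun i (Lp.aestronglyMeasurable f),
    (X.eLpNorm_rnFun_le i (Lp.aestronglyMeasurable f)).trans_lt (Lp.eLpNorm_lt_top f)⟩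

/-- The bounded operator `s i : f ↦ 1_{a i} (dm∘θ/dm)^{1/2} f∘θ` on `L²(Ω, m)`. -/
def s (X : MarkovFibredSystem Ω m I) [Countable I] (i : I) : Lp ℂ 2 m →L[ℂ] Lp ℂ 2 m :=
  LinearMap.mkContinuous
    { toFun := fun f => (X.memLp_rnFun i f).toLp _
      map_add' := fun f g => by
        rw [← MemLp.toLp_add]
        refine MemLp.toLp_congr _ _ ?_
        filter_upwards [X.quasi.ae_eq_comp (Lp.coeFn_add f g)] with x hx
        have hx' : (f + g : Lp ℂ 2 m) (X.θ x) = f (X.θ x) + g (X.θ x) := hx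
        by_cases h : x ∈ X.a i
        · simp only [rnFun, Set.indicator_of_mem h, Pi.add_apply, hx', mul_add]
        · simp only [rnFun, Set.indicator_of_notMem h, Pi.add_apply, add_zero]
      map_smul' := fun c f => by
        rw [RingHom.id_apply, ← MemLp.toLp_const_smul]
        refine MemLp.toLp_congr _ _ ?_
        filter_upwards [X.quasi.ae_eq_comp (Lp.coeFn_smul c f)] with x hx
        have hx' : (c • f : Lp ℂ 2 m) (X.θ x) = c * f (X.θ x) := hx
        by_cases h : x ∈ X.a i <;> simp [rnFun, h, hx', mul_left_comm] }
    1 fun f => by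
      rw [one_mul, LinearMap.coe_mk, AddHom.coe_mk, Lp.norm_toLp, Lp.norm_def]
      exact ENNReal.toReal_mono (Lp.eLpNorm_ne_top f)
        (X.eLpNorm_rnFun_le i (Lp.aestronglyMeasurable f))

theorem s_apply (X : MarkovFibredSystem Ω m I) [Countable I] (i : I) (f : Lp ℂ 2 m) :
    X.s i f =ᵐ[m] X.rnFun i f :=
  (X.memLp_rnFun i f).coeFn_toLp

/-- The Radon–Nikodym representation `ℛ_A(m)`: the `C*`-algebra of operators on `L²(Ω, m)`
generated by the `s i`. (For a finite partition it contains the identity `∑ i, s i (s i)*`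
anyway, so that generating it as a unital algebra makes no difference.) -/
def RNRep (X : MarkovFibredSystem Ω m I) [Countable I] :
    StarSubalgebra ℂ (Lp ℂ 2 m →L[ℂ] Lp ℂ 2 m) :=
  (StarAlgebra.adjoin ℂ (Set.range X.s)).topologicalClosure

theorem s_mem_RNRep (X : MarkovFibredSystem Ω m I) [Countable I] (i : I) : X.s i ∈ X.RNRep :=
  StarSubalgebra.le_topologicalClosure _ (StarAlgebra.subset_adjoin ℂ _ ⟨i, rfl⟩)

end Polish

end MarkovFibredSystem

end

/-!
Both `C*`-algebras are generated by Cuntz–Krieger families for the incidence matrix `A`, and the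
proof is the Cuntz–Krieger uniqueness theorem: if `T` is a Cuntz–Krieger family in a `C*`-algebra
`B`, `A` satisfies condition (I), and `π : B → B'` is a `*`-homomorphism with `π (T i) ≠ 0` for all
`i`, then `π` is isometric on the `*`-algebra generated by the `T i`
(`IsCuntzKriegerFamily.norm_map_of_mem_adjoin`).

* Every `*`-polynomial in the generators is a sum of components `x k ∈ homogeneous T k`, spanned by
  the `T_α (T_β)*` with `|α| - |β| = k`. Those of degree zero lie in a finite-dimensional
  `C*`-algebra, the `core` of some level.
* Let `γ` be a path without overlaps by `1, …, K` letters. Compression by the projection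
  `∑ T_μ T_γ (T_γ)* (T_μ)*` kills the components of degree `k` for `1 ≤ |k| ≤ K`. With one such path
  for each initial vertex, the compressions of the core by the images of these projections under `π`
  form an injective, hence isometric, `*`-homomorphism (`injective_coreCompression`). Thus
  `‖x 0‖ ≤ ‖π x‖` (`norm_degree_zero_le`).
* Applied to `y* y`, whose component of degree zero is `∑ k, (y k)* (y k)`, this gives
  `‖y‖ ≤ (2 K + 1) ‖π y‖` for `y` with degrees in `[-K, K]`. The constant grows only linearly with
  the degree, so applying this to the powers of `y* y` gives `‖y‖ ≤ ‖π y‖`. Neither a gauge action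
  nor a conditional expectation is needed.

Condition (I) holds for an irreducible `A` that is not a permutation matrix: a long path `u` that
ends at a vertex with two successors `a ≠ b` can be continued in two ways, and two short periods of
`u a` and `u b` would force `a = b` (`noOverlap_or`).

The operators `s i` form a Cuntz–Krieger family (`MarkovFibredSystem.isCuntzKriegerFamily_s`): the
change of variables on `a i` shows that `(s i)* (s i)` is multiplication by the indicator function of
`θ (a i)`, and `s i (s i)*` is multiplication by that of `a i` since the density vanishes almost
nowhere. Finally `L²(Ω, m)` is separable and, by a trace argument, infinite-dimensional, so that it
is isomorphic to `ℓ²(ℕ)` and `s` is the image of the universal family under an evaluation.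
-/

namespace IsCuntzKriegerFamily

/-! ### Words in a Cuntz–Krieger family -/

section Words

variable {I B : Type*} [Fintype I] [CStarAlgebra B] {A : Matrix I I ℤ} {T : I → B}

/-- The product `T i₁ * T i₂ * ⋯ * T iₙ` along the word `[i₁, i₂, …, iₙ]`. -/
noncomputable def word (T : I → B) (l : List I) : B := (l.map T).prod

omit [Fintype I] in
@[simp] theorem word_nil : word T [] = 1 := rfl

omit [Fintype I] in
@[simp] theorem word_cons (i : I) (l : List I) : word T (i :: l) = T i * word T l := by
  simp [word]

omit [Fintype I] in
@[simp] theorem word_append (l l' : List I) : word T (l ++ l') = word T l * word T l' := by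
  simp [word]

theorem star_mul_mul_star (hT : IsCuntzKriegerFamily A T) (i : I) :
    star (T i) * T i * star (T i) = star (T i) := by
  have h := congrArg star (hT.partial_isometry i)
  simpa [star_mul, mul_assoc] using h

theorem source_mul_source (hT : IsCuntzKriegerFamily A T) (i : I) :
    star (T i) * T i * (star (T i) * T i) = star (T i) * T i := by
  rw [← mul_assoc, hT.star_mul_mul_star]

/-- Projections in a `C*`-algebra with sum `1` are mutually orthogonal, so that distinct
generators have orthogonal ranges. -/
theorem star_mul_of_ne (hT : IsCuntzKriegerFamily A T) {i j : I} (h : i ≠ j) :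
    star (T i) * T j = 0 := by
  classical
  let _ := CStarAlgebra.spectralOrder B
  have := CStarAlgebra.spectralOrderedRing B
  set p : I → B := fun k => T k * star (T k) with hp
  have hpp (k) : p k * p k = p k := by
    simp only [hp]
    rw [← mul_assoc, hT.partial_isometry]
  have hps (k) : star (p k) = p k := by simp [hp]
  have h1 (k) : star (p k * p j) * (p k * p j) = p j * p k * p j := by
    rw [star_mul, hps, hps, mul_assoc, ← mul_assoc (p k), hpp, ← mul_assoc]
  have h2 : ∑ k, star (p k * p j) * (p k * p j) = p j := by
    simp_rw [h1]
    rw [← Finset.sum_mul, ← Finset.mul_sum, hT.sum_range, mul_one, hpp]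
  rw [← Finset.add_sum_erase _ _ (Finset.mem_univ j), h1, hpp, hpp, add_eq_left,
    Finset.sum_eq_zero_iff_of_nonneg fun k _ => star_mul_self_nonneg _] at h2
  have h3 : p i * p j = 0 :=
    CStarRing.star_mul_self_eq_zero_iff _ |>.1 (h2 i (by simp [h]))
  calc star (T i) * T j = star (T i) * (p i * p j) * T j := by
        simp only [hp]
        have e1 := hT.star_mul_mul_star i
        have e2 := hT.partial_isometry j
        simp only [← mul_assoc]
        rw [e1, mul_assoc (star (T i) * T j), mul_assoc (star (T i)), ← mul_assoc (T j), e2]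
    _ = 0 := by rw [h3, mul_zero, zero_mul]

theorem source_mul (hT : IsCuntzKriegerFamily A T) (i k : I) :
    star (T i) * T i * T k = A i k • T k := by
  classical
  rw [hT.source, Finset.sum_mul, Finset.sum_eq_single k]
  · rw [smul_mul_assoc, hT.partial_isometry]
  · intro j _ hj
    rw [smul_mul_assoc, mul_assoc, hT.star_mul_of_ne hj, mul_zero, smul_zero]
  · simp

theorem source_mul_eq_zero_or (hT : IsCuntzKriegerFamily A T)
    (hA : ∀ i j, A i j = 0 ∨ A i j = 1) (i k : I) :
    star (T i) * T i * T k = 0 ∨ star (T i) * T i * T k = T k := by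
  rw [hT.source_mul]
  rcases hA i k with h | h <;> simp [h]

theorem star_word_mul_word_of_length_lt (hT : IsCuntzKriegerFamily A T)
    (hA : ∀ i j, A i j = 0 ∨ A i j = 1) (β μ : List I) (h : β.length < μ.length) :
    star (word T β) * word T μ = 0 ∨ star (word T β) * word T μ = word T (μ.drop β.length) := by
  induction β generalizing μ with
  | nil => simp
  | cons i β ih =>
    match μ, h with
    | j :: k :: μ, h =>
      have e : star (word T (i :: β)) * word T (j :: k :: μ)
          = star (word T β) * (star (T i) * T j * T k) * word T μ := by
        simp [mul_assoc]
      rw [e]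
      by_cases hij : i = j
      · subst hij
        rcases hT.source_mul_eq_zero_or hA i k with h' | h'
        · simp [h']
        · rw [h', mul_assoc, ← word_cons]
          exact ih (k :: μ) (by simpa using h)
      · simp [hT.star_mul_of_ne hij]
    | [j], h => simp at h

theorem star_word_mul_word_of_ne (hT : IsCuntzKriegerFamily A T)
    (hA : ∀ i j, A i j = 0 ∨ A i j = 1) (β μ : List I) (h : β.length = μ.length) (hne : β ≠ μ) :
    star (word T β) * word T μ = 0 := by
  induction β generalizing μ with
  | nil => cases μ <;> simp_all
  | cons i β ih =>
    match μ, h, hne with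
    | j :: μ, h, hne =>
      have e : star (word T (i :: β)) * word T (j :: μ)
          = star (word T β) * (star (T i) * T j) * word T μ := by
        simp [mul_assoc]
      rw [e]
      by_cases hij : i = j
      · subst hij
        match μ, h, hne with
        | [], h, hne => simp_all
        | k :: μ, h, hne =>
          rw [word_cons, mul_assoc, ← mul_assoc _ (T k)]
          rcases hT.source_mul_eq_zero_or hA i k with h' | h'
          · simp [h']
          · rw [h', ← word_cons]
            exact ih _ (by simpa using h) (by simpa using hne)
      · simp [hT.star_mul_of_ne hij]

/-- Words of equal positive length multiply like matrix units. -/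
theorem star_word_mul_word_concat (hT : IsCuntzKriegerFamily A T)
    (hA : ∀ i j, A i j = 0 ∨ A i j = 1) (β α : List I) (i j : I) (h : β.length = α.length) :
    star (word T (β ++ [i])) * word T (α ++ [j]) = 0 ∨
      i = j ∧ star (word T (β ++ [i])) * word T (α ++ [j]) = star (T i) * T i := by
  by_cases hne : β ++ [i] = α ++ [j]
  · obtain ⟨rfl, hij⟩ := List.append_inj hne h
    obtain rfl : i = j := by simpa using hij
    have e : star (word T (β ++ [i])) * word T (β ++ [i])
        = star (T i) * (star (word T β) * word T (β ++ [i])) := by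
      simp [mul_assoc]
    rw [e]
    rcases hT.star_word_mul_word_of_length_lt hA β (β ++ [i]) (by simp) with h' | h'
    · left
      rw [h', mul_zero]
    · right
      rw [h']
      simp
  · left
    exact hT.star_word_mul_word_of_ne hA _ _ (by simp [h]) hne

/-- A word along a path of the graph of `A` does not vanish. -/
theorem word_ne_zero (hT : IsCuntzKriegerFamily A T) (h0 : ∀ i, T i ≠ 0) (i : I) (l : List I)
    (hl : (i :: l).IsChain fun i j => A i j = 1) : word T (i :: l) ≠ 0 := by
  induction l generalizing i with
  | nil => simpa using h0 i
  | cons j l ih =>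
    intro h
    rw [List.isChain_cons_cons] at hl
    refine ih j hl.2 ?_
    have e : star (T i) * word T (i :: j :: l) = star (T i) * T i * T j * word T l := by
      simp [mul_assoc]
    rw [h, mul_zero, hT.source_mul, hl.1, one_smul] at e
    rw [word_cons, ← e]

/-- An element is determined by its corners at words of a given length. -/
theorem eq_zero_of_corners (hT : IsCuntzKriegerFamily A T) (n : ℕ) (x : B)
    (h : ∀ α β : List I, α.length = n → β.length = n → star (word T α) * x * word T β = 0) :
    x = 0 := by
  induction n generalizing x with
  | zero => simpa using h [] [] rfl rfl
  | succ n ih =>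
    have key : ∀ i j, star (T i) * x * T j = 0 := fun i j => by
      refine ih _ fun α β hα hβ => ?_
      simpa [mul_assoc] using h (i :: α) (j :: β) (by simp [hα]) (by simp [hβ])
    calc x = (∑ i, T i * star (T i)) * x * ∑ j, T j * star (T j) := by simp [hT.sum_range]
      _ = ∑ i, ∑ j, T i * (star (T i) * x * T j) * star (T j) := by
        rw [Finset.sum_mul, Finset.sum_mul]
        refine Finset.sum_congr rfl fun i _ => ?_
        rw [Finset.mul_sum]
        simp [mul_assoc]
      _ = 0 := by simp [key]

end Words

/-! ### The grading by word length -/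

section Grading

variable {I B : Type*} [Fintype I] [CStarAlgebra B] {A : Matrix I I ℤ} {T : I → B}

/-- The span of the elements `T_α (T_β)*` with words `α`, `β` of lengths `p`, `q`. -/
noncomputable def bihomogeneous (T : I → B) (p q : ℕ) : Submodule ℂ B :=
  Submodule.span ℂ
    {x | ∃ α β : List I, α.length = p ∧ β.length = q ∧ x = word T α * star (word T β)}

theorem bihomogeneous_le_add (hT : IsCuntzKriegerFamily A T) (p q n : ℕ) :
    bihomogeneous T p q ≤ bihomogeneous T (p + n) (q + n) := by
  induction n with
  | zero => exact le_rfl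
  | succ n ih =>
    refine ih.trans (Submodule.span_le.2 ?_)
    rintro _ ⟨α, β, hα, hβ, rfl⟩
    have e : word T α * star (word T β)
        = ∑ j, word T (α ++ [j]) * star (word T (β ++ [j])) := by
      calc _ = word T α * (∑ j, T j * star (T j)) * star (word T β) := by simp [hT.sum_range]
        _ = _ := by simp [Finset.mul_sum, Finset.sum_mul, mul_assoc]
    rw [e]
    exact Submodule.sum_mem _ fun j _ => Submodule.subset_span
      ⟨_, _, by simp [hα, add_assoc], by simp [hβ, add_assoc], rfl⟩

theorem mul_mem_bihomogeneous (hT : IsCuntzKriegerFamily A T)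
    (hA : ∀ i j, A i j = 0 ∨ A i j = 1) {p q n s : ℕ} {x y : B}
    (hx : x ∈ bihomogeneous T p q) (hy : y ∈ bihomogeneous T (q + (n + 1)) s) :
    x * y ∈ bihomogeneous T (p + (n + 1)) s := by
  refine Submodule.span_induction₂ (p := fun x y _ _ => x * y ∈ bihomogeneous T (p + (n + 1)) s)
    ?_ ?_ ?_ ?_ ?_ ?_ ?_ hx hy
  · rintro _ _ ⟨α, β, hα, hβ, rfl⟩ ⟨μ, ν, hμ, hν, rfl⟩
    have e : word T α * star (word T β) * (word T μ * star (word T ν))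
        = word T α * (star (word T β) * word T μ) * star (word T ν) := by
      simp [mul_assoc]
    rw [e]
    rcases hT.star_word_mul_word_of_length_lt hA β μ (by omega) with h | h
    · simp [h]
    · rw [h, ← word_append]
      exact Submodule.subset_span ⟨_, _, by simp; omega, hν, rfl⟩
  · simp
  · simp
  · intro x y z _ _ _ h1 h2
    rw [add_mul]
    exact add_mem h1 h2
  · intro x y z _ _ _ h1 h2
    rw [mul_add]
    exact add_mem h1 h2
  · intro r x y _ _ h
    rw [smul_mul_assoc]
    exact Submodule.smul_mem _ _ h
  · intro r x y _ _ h
    rw [mul_smul_comm]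
    exact Submodule.smul_mem _ _ h

omit [Fintype I] in
theorem star_mem_bihomogeneous {p q : ℕ} {x : B} (hx : x ∈ bihomogeneous T p q) :
    star x ∈ bihomogeneous T q p := by
  induction hx using Submodule.span_induction with
  | mem x hx =>
    obtain ⟨α, β, hα, hβ, rfl⟩ := hx
    exact Submodule.subset_span ⟨β, α, hβ, hα, by simp⟩
  | zero => simp
  | add x y _ _ h1 h2 => simpa using add_mem h1 h2
  | smul r x _ h => simpa using Submodule.smul_mem _ _ h

/-- The elements of degree `k`: the span of all `T_α (T_β)*` with `|α| - |β| = k`. -/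
noncomputable def homogeneous (T : I → B) (k : ℤ) : Submodule ℂ B :=
  ⨆ N : ℕ, bihomogeneous T (N + k.toNat) (N + (-k).toNat)

theorem bihomogeneous_monotone (hT : IsCuntzKriegerFamily A T) (k : ℤ) :
    Monotone fun N : ℕ => bihomogeneous T (N + k.toNat) (N + (-k).toNat) := by
  intro N M h
  obtain ⟨n, rfl⟩ := Nat.exists_eq_add_of_le h
  have := hT.bihomogeneous_le_add (N + k.toNat) (N + (-k).toNat) n
  simpa only [add_right_comm] using this

theorem mem_homogeneous_iff (hT : IsCuntzKriegerFamily A T) {k : ℤ} {x : B} :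
    x ∈ homogeneous T k ↔ ∃ N : ℕ, x ∈ bihomogeneous T (N + k.toNat) (N + (-k).toNat) :=
  Submodule.mem_iSup_of_directed _ (hT.bihomogeneous_monotone k).directed_le

omit [Fintype I] in
theorem bihomogeneous_le_homogeneous {p q : ℕ} {k : ℤ} (h : (p : ℤ) - q = k) :
    bihomogeneous T p q ≤ homogeneous T k := by
  have hp : min p q + k.toNat = p := by omega
  have hq : min p q + (-k).toNat = q := by omega
  have := le_iSup (fun N : ℕ => bihomogeneous T (N + k.toNat) (N + (-k).toNat)) (min p q)
  rwa [hp, hq] at this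

theorem mul_mem_homogeneous (hT : IsCuntzKriegerFamily A T)
    (hA : ∀ i j, A i j = 0 ∨ A i j = 1) {k l : ℤ} {x y : B}
    (hx : x ∈ homogeneous T k) (hy : y ∈ homogeneous T l) : x * y ∈ homogeneous T (k + l) := by
  obtain ⟨N, hx⟩ := hT.mem_homogeneous_iff.1 hx
  obtain ⟨M, hy⟩ := hT.mem_homogeneous_iff.1 hy
  -- the factor `y` is moved to a level at which its left words are longer than the right words
  -- of `x`
  have hy' := hT.bihomogeneous_le_add _ _ (N + (-k).toNat + 1) hy
  have e : M + l.toNat + (N + (-k).toNat + 1) = N + (-k).toNat + (M + l.toNat + 1) := by ring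
  rw [e] at hy'
  exact bihomogeneous_le_homogeneous (by push_cast; omega) (hT.mul_mem_bihomogeneous hA hx hy')

theorem star_mem_homogeneous (hT : IsCuntzKriegerFamily A T) {k : ℤ} {x : B}
    (hx : x ∈ homogeneous T k) : star x ∈ homogeneous T (-k) := by
  obtain ⟨N, hx⟩ := hT.mem_homogeneous_iff.1 hx
  exact bihomogeneous_le_homogeneous (by omega) (star_mem_bihomogeneous hx)

/-- The sums of elements of degrees between `-K` and `K`. -/
noncomputable def degreeLE (T : I → B) (K : ℕ) : Submodule ℂ B :=
  ⨆ k ∈ Finset.Icc (-K : ℤ) K, homogeneous T k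

omit [Fintype I] in
theorem homogeneous_le_degreeLE {k : ℤ} {K : ℕ} (h : k ∈ Finset.Icc (-K : ℤ) K) :
    homogeneous T k ≤ degreeLE T K :=
  le_biSup (homogeneous T) h

omit [Fintype I] in
theorem degreeLE_mono {K L : ℕ} (h : K ≤ L) : degreeLE T K ≤ degreeLE T L :=
  biSup_mono fun k hk => by simp only [Finset.mem_Icc] at hk ⊢; omega

omit [Fintype I] in
theorem mem_degreeLE_iff {K : ℕ} {x : B} :
    x ∈ degreeLE T K ↔ ∃ y : ℤ → B, (∀ k, y k ∈ homogeneous T k) ∧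
      ∑ k ∈ Finset.Icc (-K : ℤ) K, y k = x := by
  rw [degreeLE, Submodule.mem_iSup_finset_iff_exists_sum]
  exact ⟨fun ⟨μ, h⟩ => ⟨fun k => μ k, fun k => (μ k).2, h⟩,
    fun ⟨y, hy, h⟩ => ⟨fun k => ⟨y k, hy k⟩, h⟩⟩

theorem mul_mem_degreeLE (hT : IsCuntzKriegerFamily A T)
    (hA : ∀ i j, A i j = 0 ∨ A i j = 1) {K L : ℕ} {x y : B}
    (hx : x ∈ degreeLE T K) (hy : y ∈ degreeLE T L) : x * y ∈ degreeLE T (K + L) := by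
  obtain ⟨a, ha, rfl⟩ := mem_degreeLE_iff.1 hx
  obtain ⟨b, hb, rfl⟩ := mem_degreeLE_iff.1 hy
  rw [Finset.sum_mul_sum]
  refine Submodule.sum_mem _ fun k hk => Submodule.sum_mem _ fun l hl => ?_
  refine homogeneous_le_degreeLE ?_ (hT.mul_mem_homogeneous hA (ha k) (hb l))
  simp only [Finset.mem_Icc, Nat.cast_add] at hk hl ⊢
  omega

theorem star_mem_degreeLE (hT : IsCuntzKriegerFamily A T) {K : ℕ} {x : B}
    (hx : x ∈ degreeLE T K) : star x ∈ degreeLE T K := by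
  obtain ⟨a, ha, rfl⟩ := mem_degreeLE_iff.1 hx
  rw [star_sum]
  refine Submodule.sum_mem _ fun k hk => ?_
  refine homogeneous_le_degreeLE ?_ (hT.star_mem_homogeneous (ha k))
  simp only [Finset.mem_Icc] at hk ⊢
  omega

omit [Fintype I] in
theorem one_mem_degreeLE (K : ℕ) : (1 : B) ∈ degreeLE T K :=
  homogeneous_le_degreeLE (k := 0) (by simp)
    (bihomogeneous_le_homogeneous (p := 0) (q := 0) (by simp)
      (Submodule.subset_span ⟨[], [], rfl, rfl, by simp⟩))

theorem pow_mem_degreeLE (hT : IsCuntzKriegerFamily A T)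
    (hA : ∀ i j, A i j = 0 ∨ A i j = 1) {K : ℕ} {x : B} (hx : x ∈ degreeLE T K) (n : ℕ) :
    x ^ n ∈ degreeLE T (n * K) := by
  induction n with
  | zero => simpa using one_mem_degreeLE _
  | succ n ih =>
    rw [pow_succ, add_mul, one_mul]
    exact hT.mul_mem_degreeLE hA ih hx

theorem exists_mem_degreeLE (hT : IsCuntzKriegerFamily A T)
    (hA : ∀ i j, A i j = 0 ∨ A i j = 1) {x : B} (hx : x ∈ StarAlgebra.adjoin ℂ (Set.range T)) :
    ∃ K, x ∈ degreeLE T K := by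
  induction hx using StarAlgebra.adjoin_induction with
  | mem x hx =>
    obtain ⟨i, rfl⟩ := hx
    exact ⟨1, homogeneous_le_degreeLE (k := 1) (by simp)
      (bihomogeneous_le_homogeneous (p := 1) (q := 0) (by simp)
        (Submodule.subset_span ⟨[i], [], rfl, rfl, by simp⟩))⟩
  | algebraMap r =>
    refine ⟨0, ?_⟩
    rw [Algebra.algebraMap_eq_smul_one]
    exact Submodule.smul_mem _ _ (one_mem_degreeLE _)
  | add x y _ _ hx hy =>
    obtain ⟨K, hK⟩ := hx
    obtain ⟨L, hL⟩ := hy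
    exact ⟨max K L, add_mem (degreeLE_mono (le_max_left _ _) hK)
      (degreeLE_mono (le_max_right _ _) hL)⟩
  | mul x y _ _ hx hy =>
    obtain ⟨K, hK⟩ := hx
    obtain ⟨L, hL⟩ := hy
    exact ⟨K + L, hT.mul_mem_degreeLE hA hK hL⟩
  | star x _ hx =>
    obtain ⟨K, hK⟩ := hx
    exact ⟨K, hT.star_mem_degreeLE hK⟩

end Grading

/-! ### The finite-dimensional core -/

section Core

variable {I B : Type*} [Fintype I] [CStarAlgebra B] {A : Matrix I I ℤ} {T : I → B}

/-- The matrix units `T_{αi} (T_{βi})*` with words `α`, `β` of length `N`. -/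
noncomputable def matrixUnits (T : I → B) (N : ℕ) : Set B :=
  {x | ∃ (i : I) (α β : List I), α.length = N ∧ β.length = N ∧
    x = word T (α ++ [i]) * star (word T (β ++ [i]))}

theorem finite_matrixUnits (N : ℕ) : (matrixUnits T N).Finite := by
  have h := (Set.finite_univ (α := I)).prod
    ((List.finite_length_eq I N).prod (List.finite_length_eq I N))
  refine (h.image fun t => word T (t.2.1 ++ [t.1]) * star (word T (t.2.2 ++ [t.1]))).subset ?_
  rintro _ ⟨i, α, β, hα, hβ, rfl⟩
  exact ⟨(i, α, β), ⟨Set.mem_univ _, hα, hβ⟩, rfl⟩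

theorem mul_mem_span_matrixUnits (hT : IsCuntzKriegerFamily A T)
    (hA : ∀ i j, A i j = 0 ∨ A i j = 1) {N : ℕ} {x y : B}
    (hx : x ∈ Submodule.span ℂ (matrixUnits T N)) (hy : y ∈ Submodule.span ℂ (matrixUnits T N)) :
    x * y ∈ Submodule.span ℂ (matrixUnits T N) := by
  refine Submodule.span_induction₂
    (p := fun x y _ _ => x * y ∈ Submodule.span ℂ (matrixUnits T N)) ?_ ?_ ?_ ?_ ?_ ?_ ?_ hx hy
  · rintro _ _ ⟨i, α, β, hα, hβ, rfl⟩ ⟨j, μ, ν, hμ, hν, rfl⟩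
    have e : word T (α ++ [i]) * star (word T (β ++ [i])) *
          (word T (μ ++ [j]) * star (word T (ν ++ [j])))
        = word T (α ++ [i]) * (star (word T (β ++ [i])) * word T (μ ++ [j])) *
          star (word T (ν ++ [j])) := by
      simp only [mul_assoc]
    rw [e]
    rcases hT.star_word_mul_word_concat hA β μ i j (by omega) with h | ⟨rfl, h⟩
    · rw [h, mul_zero, zero_mul]
      exact zero_mem _
    · have e' : word T (α ++ [i]) * (star (T i) * T i) = word T (α ++ [i]) := by
        have := hT.partial_isometry i
        rw [mul_assoc] at this
        simp [mul_assoc, this]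
      rw [h, e']
      exact Submodule.subset_span ⟨i, α, ν, hα, hν, rfl⟩
  · simp
  · simp
  · intro x y z _ _ _ h1 h2
    rw [add_mul]
    exact add_mem h1 h2
  · intro x y z _ _ _ h1 h2
    rw [mul_add]
    exact add_mem h1 h2
  · intro r x y _ _ h
    rw [smul_mul_assoc]
    exact Submodule.smul_mem _ _ h
  · intro r x y _ _ h
    rw [mul_smul_comm]
    exact Submodule.smul_mem _ _ h

/-- The finite-dimensional `C*`-algebra spanned by the matrix units of level `N`. -/
noncomputable def core (hT : IsCuntzKriegerFamily A T) (hA : ∀ i j, A i j = 0 ∨ A i j = 1) (N : ℕ) :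
    NonUnitalStarSubalgebra ℂ B where
  __ := Submodule.span ℂ (matrixUnits T N)
  mul_mem' := hT.mul_mem_span_matrixUnits hA
  star_mem' := by
    intro x hx
    change star x ∈ Submodule.span ℂ (matrixUnits T N)
    replace hx : x ∈ Submodule.span ℂ (matrixUnits T N) := hx
    induction hx using Submodule.span_induction with
    | mem x hx =>
      obtain ⟨i, α, β, hα, hβ, rfl⟩ := hx
      exact Submodule.subset_span ⟨i, β, α, hβ, hα, by simp⟩
    | zero => simp
    | add x y _ _ h1 h2 =>
      rw [star_add]
      exact add_mem h1 h2
    | smul r x _ h =>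
      rw [star_smul]
      exact Submodule.smul_mem _ _ h

theorem isClosed_core (hT : IsCuntzKriegerFamily A T) (hA : ∀ i j, A i j = 0 ∨ A i j = 1)
    (N : ℕ) : IsClosed (hT.core hA N : Set B) := by
  have := FiniteDimensional.span_of_finite ℂ (finite_matrixUnits (T := T) N)
  exact Submodule.closed_of_finiteDimensional (Submodule.span ℂ (matrixUnits T N))

theorem bihomogeneous_le_core (hT : IsCuntzKriegerFamily A T)
    (hA : ∀ i j, A i j = 0 ∨ A i j = 1) {N : ℕ} {x : B} (hx : x ∈ bihomogeneous T N N) :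
    x ∈ hT.core hA N := by
  refine Submodule.span_le.2 ?_ hx
  rintro _ ⟨α, β, hα, hβ, rfl⟩
  have e : word T α * star (word T β)
      = ∑ j, word T (α ++ [j]) * star (word T (β ++ [j])) := by
    calc _ = word T α * (∑ j, T j * star (T j)) * star (word T β) := by simp [hT.sum_range]
      _ = _ := by simp [Finset.mul_sum, Finset.sum_mul, mul_assoc]
  rw [e]
  exact Submodule.sum_mem _ fun j _ => Submodule.subset_span ⟨j, α, β, hα, hβ, rfl⟩

/-- The corners of an element of the core are multiples of source projections; the scalar is
the coefficient of a matrix unit. -/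
theorem exists_corner_eq (hT : IsCuntzKriegerFamily A T) (hA : ∀ i j, A i j = 0 ∨ A i j = 1)
    {N : ℕ} {x : B} (hx : x ∈ hT.core hA N) {α β : List I} (hα : α.length = N)
    (hβ : β.length = N) (i j : I) :
    ∃ c : ℂ, star (word T (α ++ [i])) * x * word T (β ++ [j]) = c • (star (T i) * T i) ∧
      (i ≠ j → c = 0) := by
  replace hx : x ∈ Submodule.span ℂ (matrixUnits T N) := hx
  induction hx using Submodule.span_induction with
  | mem x hx =>
    obtain ⟨k, μ, ν, hμ, hν, rfl⟩ := hx
    have e : star (word T (α ++ [i])) * (word T (μ ++ [k]) * star (word T (ν ++ [k]))) *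
          word T (β ++ [j])
        = (star (word T (α ++ [i])) * word T (μ ++ [k])) *
          (star (word T (ν ++ [k])) * word T (β ++ [j])) := by
      simp only [mul_assoc]
    rw [e]
    rcases hT.star_word_mul_word_concat hA α μ i k (by omega) with h | ⟨rfl, h⟩
    · exact ⟨0, by rw [h, zero_mul, zero_smul], fun _ => rfl⟩
    rcases hT.star_word_mul_word_concat hA ν β i j (by omega) with h' | ⟨rfl, h'⟩
    · exact ⟨0, by rw [h', mul_zero, zero_smul], fun _ => rfl⟩
    · exact ⟨1, by rw [h, h', hT.source_mul_source, one_smul], fun h => absurd rfl h⟩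
  | zero => exact ⟨0, by simp, fun _ => rfl⟩
  | add x y _ _ h1 h2 =>
    obtain ⟨c, hc, hc'⟩ := h1
    obtain ⟨d, hd, hd'⟩ := h2
    exact ⟨c + d, by rw [mul_add, add_mul, hc, hd, add_smul], fun h => by simp [hc' h, hd' h]⟩
  | smul r x _ h =>
    obtain ⟨c, hc, hc'⟩ := h
    exact ⟨r * c, by rw [mul_smul_comm, smul_mul_assoc, hc, smul_smul],
      fun h => by simp [hc' h]⟩

end Core

/-! ### Compression by words without self-overlap -/

section Compression

variable {I B : Type*} [Fintype I] [CStarAlgebra B] {A : Matrix I I ℤ} {T : I → B}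

/-- The canonical completely positive map `x ↦ ∑ i, T i x (T i)*`. -/
noncomputable def shift (T : I → B) (x : B) : B := ∑ i, T i * x * star (T i)

theorem star_shift (x : B) : star (shift T x) = shift T (star x) := by
  simp [shift, mul_assoc]

theorem shift_mul_range (hT : IsCuntzKriegerFamily A T) (x : B) (k : I) :
    shift T x * (T k * star (T k)) = T k * x * star (T k) := by
  classical
  rw [shift, Finset.sum_mul, Finset.sum_eq_single k]
  · rw [mul_assoc (T k * x), ← mul_assoc (star (T k)), hT.star_mul_mul_star]
  · intro j _ hj
    rw [mul_assoc (T j * x), ← mul_assoc (star (T j)), hT.star_mul_of_ne hj, zero_mul, mul_zero]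
  · simp

theorem range_mul_shift (hT : IsCuntzKriegerFamily A T) (x : B) (k : I) :
    T k * star (T k) * shift T x = T k * x * star (T k) := by
  have h := congrArg star (hT.shift_mul_range (star x) k)
  simpa [star_shift, mul_assoc] using h

theorem commute_shift_range (hT : IsCuntzKriegerFamily A T) (x : B) (k : I) :
    Commute (shift T x) (T k * star (T k)) :=
  (hT.shift_mul_range x k).trans (hT.range_mul_shift x k).symm

theorem commute_source (hT : IsCuntzKriegerFamily A T) {x : B}
    (hx : ∀ k, Commute x (T k * star (T k))) (i : I) : Commute x (star (T i) * T i) := by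
  rw [hT.source]
  exact Commute.sum_right _ _ _ fun j _ => (hx j).smul_right _

theorem shift_mul (hT : IsCuntzKriegerFamily A T) {x : B}
    (hx : ∀ k, Commute x (T k * star (T k))) (i : I) : shift T x * T i = T i * x := by
  have h1 := hT.partial_isometry i
  calc shift T x * T i = shift T x * (T i * star (T i)) * T i := by rw [mul_assoc, h1]
    _ = T i * (x * (star (T i) * T i)) := by rw [hT.shift_mul_range]; simp only [mul_assoc]
    _ = T i * x := by
      rw [(hT.commute_source hx i).eq, ← mul_assoc, ← mul_assoc, h1]

theorem shift_mul_shift (hT : IsCuntzKriegerFamily A T) {x : B}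
    (hx : ∀ k, Commute x (T k * star (T k))) (y : B) :
    shift T x * shift T y = shift T (x * y) := by
  conv_lhs => rw [shift.eq_def T y]
  rw [Finset.mul_sum]
  refine Finset.sum_congr rfl fun i _ => ?_
  rw [← mul_assoc, ← mul_assoc, hT.shift_mul hx, mul_assoc (T i)]

theorem commute_iterate_shift (hT : IsCuntzKriegerFamily A T) {x : B}
    (hx : ∀ k, Commute x (T k * star (T k))) (n : ℕ) (k : I) :
    Commute ((shift T)^[n] x) (T k * star (T k)) := by
  cases n with
  | zero => exact hx k
  | succ n =>
    rw [Function.iterate_succ_apply']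
    exact hT.commute_shift_range _ k

theorem iterate_shift_mul_word (hT : IsCuntzKriegerFamily A T) {x : B}
    (hx : ∀ k, Commute x (T k * star (T k))) (α : List I) :
    (shift T)^[α.length] x * word T α = word T α * x := by
  induction α with
  | nil => simp
  | cons i α ih =>
    rw [List.length_cons, Function.iterate_succ_apply', word_cons, ← mul_assoc,
      hT.shift_mul (hT.commute_iterate_shift hx _), mul_assoc, ih, mul_assoc]

theorem iterate_shift_mul_iterate_shift (hT : IsCuntzKriegerFamily A T) {x : B}
    (hx : ∀ k, Commute x (T k * star (T k))) (y : B) (n : ℕ) :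
    (shift T)^[n] x * (shift T)^[n] y = (shift T)^[n] (x * y) := by
  induction n with
  | zero => rfl
  | succ n ih =>
    simp only [Function.iterate_succ_apply']
    rw [hT.shift_mul_shift (hT.commute_iterate_shift hx n), ih]

theorem star_iterate_shift (x : B) (n : ℕ) : star ((shift T)^[n] x) = (shift T)^[n] (star x) := by
  induction n with
  | zero => rfl
  | succ n ih => simp only [Function.iterate_succ_apply', star_shift, ih]

/-- `[i₁, …, iₙ]` and its translates by at most `K` letters disagree: the word does not have a
period `k` with `1 ≤ k ≤ K`. -/
def NoOverlap (K : ℕ) (γ : List I) : Prop :=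
  ∀ δ : List I, 1 ≤ δ.length → δ.length ≤ K → ¬ γ <+: δ ++ γ

/-- The range projection of a word. -/
noncomputable def wordProj (T : I → B) (γ : List I) : B := word T γ * star (word T γ)

omit [Fintype I] in
theorem star_wordProj (γ : List I) : star (wordProj T γ) = wordProj T γ := by
  simp [wordProj]

theorem word_mul_star_mul_word (hT : IsCuntzKriegerFamily A T)
    (hA : ∀ i j, A i j = 0 ∨ A i j = 1) (γ : List I) :
    word T γ * star (word T γ) * word T γ = word T γ := by
  induction γ with
  | nil => simp
  | cons i γ ih =>
    cases γ with
    | nil => simpa using hT.partial_isometry i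
    | cons j γ =>
      have e : word T (i :: j :: γ) * star (word T (i :: j :: γ)) * word T (i :: j :: γ)
          = T i * (word T (j :: γ) * (star (word T (j :: γ)) *
            (star (T i) * T i * T j * word T γ))) := by
        simp only [word_cons, star_mul, mul_assoc]
      rw [e]
      rcases hT.source_mul_eq_zero_or hA i j with h | h
      · have e' : word T (i :: j :: γ) = T i * (star (T i) * T i * T j) * word T γ := by
          rw [← mul_assoc, ← mul_assoc, hT.partial_isometry]
          simp [mul_assoc]
        rw [e', h]
        simp
      · rw [h, ← word_cons, ← mul_assoc (word T (j :: γ)), ih, ← word_cons]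

theorem wordProj_mul_self (hT : IsCuntzKriegerFamily A T)
    (hA : ∀ i j, A i j = 0 ∨ A i j = 1) (γ : List I) :
    wordProj T γ * wordProj T γ = wordProj T γ := by
  rw [wordProj, ← mul_assoc, hT.word_mul_star_mul_word hA]

theorem range_mul_word (hT : IsCuntzKriegerFamily A T) (k i : I) (γ : List I) :
    T k * star (T k) * word T (i :: γ) = 0 ∨
      T k * star (T k) * word T (i :: γ) = word T (i :: γ) := by
  by_cases h : k = i
  · subst h
    right
    rw [word_cons, ← mul_assoc, hT.partial_isometry]
  · left
    rw [word_cons, mul_assoc, ← mul_assoc (star (T k)), hT.star_mul_of_ne h, zero_mul, mul_zero]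

theorem commute_wordProj (hT : IsCuntzKriegerFamily A T) (i : I) (γ : List I) (k : I) :
    Commute (wordProj T (i :: γ)) (T k * star (T k)) := by
  have hs : star (T k * star (T k) * word T (i :: γ))
      = star (word T (i :: γ)) * (T k * star (T k)) := by simp only [star_mul, star_star, mul_assoc]
  change wordProj T (i :: γ) * (T k * star (T k)) = T k * star (T k) * wordProj T (i :: γ)
  rw [wordProj, mul_assoc, ← hs, ← mul_assoc (T k * star (T k))]
  rcases hT.range_mul_word k i γ with h | h <;> rw [h]
  simp only [star_zero, mul_zero, zero_mul]

/-- Compression by a word without overlaps kills all words of length between `1` and `K`. -/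
theorem star_word_mul_word_mul_word (hT : IsCuntzKriegerFamily A T)
    (hA : ∀ i j, A i j = 0 ∨ A i j = 1) {K : ℕ} {γ : List I} (hγ : NoOverlap K γ) {δ : List I}
    (h1 : 1 ≤ δ.length) (hK : δ.length ≤ K) :
    star (word T γ) * word T δ * word T γ = 0 := by
  have e : word T δ * word T γ
      = word T ((δ ++ γ).take γ.length) * word T ((δ ++ γ).drop γ.length) := by
    rw [← word_append, ← word_append, List.take_append_drop]
  rw [mul_assoc, e, ← mul_assoc, hT.star_word_mul_word_of_ne hA, zero_mul]
  · simp
  · intro h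
    exact hγ δ h1 hK (List.prefix_iff_eq_take.2 h)

theorem wordProj_mul_word_mul_wordProj (hT : IsCuntzKriegerFamily A T)
    (hA : ∀ i j, A i j = 0 ∨ A i j = 1) {K : ℕ} {γ : List I} (hγ : NoOverlap K γ) {δ : List I}
    (h1 : 1 ≤ δ.length) (hK : δ.length ≤ K) :
    wordProj T γ * word T δ * wordProj T γ = 0 := by
  have e : wordProj T γ * word T δ * wordProj T γ
      = word T γ * (star (word T γ) * word T δ * word T γ) * star (word T γ) := by
    simp only [wordProj, mul_assoc]
  rw [e, hT.star_word_mul_word_mul_word hA hγ h1 hK, mul_zero, zero_mul]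

/-- The projection `∑ T_μ T_γ (T_γ)* (T_μ)*` over all words `μ` of length `N`. -/
noncomputable def compressor (T : I → B) (γ : List I) (N : ℕ) : B := (shift T)^[N] (wordProj T γ)

theorem compressor_mul_word (hT : IsCuntzKriegerFamily A T) {i : I} {γ : List I} {α : List I} :
    compressor T (i :: γ) α.length * word T α = word T α * wordProj T (i :: γ) :=
  hT.iterate_shift_mul_word (hT.commute_wordProj i γ) α

theorem star_compressor (γ : List I) (N : ℕ) :
    star (compressor T γ N) = compressor T γ N := by
  rw [compressor, star_iterate_shift, star_wordProj]

theorem star_word_mul_compressor (hT : IsCuntzKriegerFamily A T) {i : I} {γ : List I}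
    {α : List I} :
    star (word T α) * compressor T (i :: γ) α.length
      = wordProj T (i :: γ) * star (word T α) := by
  have h := congrArg star (hT.compressor_mul_word (i := i) (γ := γ) (α := α))
  simpa only [star_mul, star_compressor, star_wordProj] using h

theorem compressor_mul_self (hT : IsCuntzKriegerFamily A T)
    (hA : ∀ i j, A i j = 0 ∨ A i j = 1) (i : I) (γ : List I) (N : ℕ) :
    compressor T (i :: γ) N * compressor T (i :: γ) N = compressor T (i :: γ) N := by
  rw [compressor, hT.iterate_shift_mul_iterate_shift (hT.commute_wordProj i γ),
    hT.wordProj_mul_self hA]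

theorem norm_compressor_le (hT : IsCuntzKriegerFamily A T)
    (hA : ∀ i j, A i j = 0 ∨ A i j = 1) (i : I) (γ : List I) (N : ℕ) :
    ‖compressor T (i :: γ) N‖ ≤ 1 :=
  norm_le_one_of_partial_isometry _ (by
    rw [star_compressor, hT.compressor_mul_self hA, hT.compressor_mul_self hA])

theorem commute_compressor (hT : IsCuntzKriegerFamily A T)
    (hA : ∀ i j, A i j = 0 ∨ A i j = 1) (i : I) (γ : List I) {N : ℕ} {x : B}
    (hx : x ∈ hT.core hA N) : Commute x (compressor T (i :: γ) N) := by
  replace hx : x ∈ Submodule.span ℂ (matrixUnits T N) := hx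
  induction hx using Submodule.span_induction with
  | mem x hx =>
    obtain ⟨k, α, β, rfl, hβ, rfl⟩ := hx
    have e : word T (α ++ [k]) * star (word T (β ++ [k]))
        = word T α * (T k * star (T k)) * star (word T β) := by simp [mul_assoc]
    have e1 := hT.compressor_mul_word (i := i) (γ := γ) (α := α)
    have e2 := hT.star_word_mul_compressor (i := i) (γ := γ) (α := β)
    rw [hβ] at e2
    change _ * _ = _ * _
    rw [e, mul_assoc _ _ (compressor _ _ _), e2, ← mul_assoc (compressor _ _ _),
      ← mul_assoc (compressor _ _ _), e1, mul_assoc (word T α) (wordProj _ _),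
      (hT.commute_wordProj i γ k).eq]
    simp only [mul_assoc]
  | zero => exact Commute.zero_left _
  | add x y _ _ h1 h2 => exact h1.add_left h2
  | smul r x _ h => exact h.smul_left r

/-- Compression by a word without overlaps kills the elements of degree `k`, `1 ≤ |k| ≤ K`. -/
theorem compressor_mul_mul_compressor (hT : IsCuntzKriegerFamily A T)
    (hA : ∀ i j, A i j = 0 ∨ A i j = 1) {K : ℕ} {i : I} {γ : List I}
    (hγ : NoOverlap K (i :: γ)) {N : ℕ} {k : ℤ} (hk0 : k ≠ 0) (hk : k ∈ Finset.Icc (-K : ℤ) K)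
    {x : B} (hx : x ∈ bihomogeneous T (N + k.toNat) (N + (-k).toNat)) :
    compressor T (i :: γ) N * x * compressor T (i :: γ) N = 0 := by
  rw [Finset.mem_Icc] at hk
  induction hx using Submodule.span_induction with
  | mem x hx =>
    obtain ⟨α, β, hα, hβ, rfl⟩ := hx
    have hαl : (α.take N).length = N := by simp [hα]
    have hβl : (β.take N).length = N := by simp [hβ]
    have e1 := hT.compressor_mul_word (i := i) (γ := γ) (α := α.take N)
    have e2 := hT.star_word_mul_compressor (i := i) (γ := γ) (α := β.take N)
    rw [hαl] at e1
    rw [hβl] at e2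
    have e : compressor T (i :: γ) N * (word T α * star (word T β)) * compressor T (i :: γ) N
        = word T (α.take N) * (wordProj T (i :: γ) * (word T (α.drop N) *
            star (word T (β.drop N))) * wordProj T (i :: γ)) * star (word T (β.take N)) := by
      calc _ = (compressor T (i :: γ) N * word T (α.take N)) * (word T (α.drop N) *
            star (word T (β.drop N))) * (star (word T (β.take N)) * compressor T (i :: γ) N) := by
            conv_lhs => rw [← List.take_append_drop N α, ← List.take_append_drop N β]
            simp only [word_append, star_mul, mul_assoc]
        _ = _ := by
            rw [e1, e2]
            simp only [mul_assoc]
    rw [e]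
    rcases lt_or_gt_of_ne hk0 with h | h
    · have hα' : α.drop N = [] := List.drop_eq_nil_of_le (by omega)
      have h0 := congrArg star (hT.wordProj_mul_word_mul_wordProj hA hγ (δ := β.drop N)
        (by simp only [List.length_drop]; omega) (by simp only [List.length_drop]; omega))
      simp only [star_mul, star_wordProj, star_zero] at h0
      rw [← mul_assoc] at h0
      rw [hα', word_nil, one_mul, h0, mul_zero, zero_mul]
    · have hβ' : β.drop N = [] := List.drop_eq_nil_of_le (by omega)
      have h0 := hT.wordProj_mul_word_mul_wordProj hA hγ (δ := α.drop N)
        (by simp only [List.length_drop]; omega) (by simp only [List.length_drop]; omega)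
      rw [hβ', word_nil, star_one, mul_one, h0, mul_zero, zero_mul]
  | zero => simp
  | add x y _ _ h1 h2 => rw [mul_add, add_mul, h1, h2, add_zero]
  | smul r x _ h => rw [mul_smul_comm, smul_mul_assoc, h, smul_zero]

end Compression

/-! ### The uniqueness theorem -/

section Uniqueness

variable {I B B' : Type*} [Fintype I] [CStarAlgebra B] [CStarAlgebra B'] {A : Matrix I I ℤ}
  {T : I → B} (π : B →⋆ₐ[ℂ] B')

protected theorem map (hT : IsCuntzKriegerFamily A T) :
    IsCuntzKriegerFamily A fun i => π (T i) where
  partial_isometry i := by simpa [map_star π] using congrArg π (hT.partial_isometry i)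
  sum_range := by simpa [map_star π] using congrArg π hT.sum_range
  source i := by simpa [map_star π] using congrArg π (hT.source i)

omit [Fintype I] in
theorem map_word (l : List I) : π (word T l) = word (fun i => π (T i)) l := by
  simp [word, map_list_prod, Function.comp_def]

omit [Fintype I] in
theorem map_mem_bihomogeneous {p q : ℕ} {x : B} (hx : x ∈ bihomogeneous T p q) :
    π x ∈ bihomogeneous (fun i => π (T i)) p q := by
  induction hx using Submodule.span_induction with
  | mem x hx =>
    obtain ⟨α, β, hα, hβ, rfl⟩ := hx
    exact Submodule.subset_span ⟨α, β, hα, hβ, by simp [map_word, map_star π]⟩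
  | zero => simp
  | add x y _ _ h1 h2 => simpa using add_mem h1 h2
  | smul r x _ h => simpa using Submodule.smul_mem _ _ h

theorem map_mem_core (hT : IsCuntzKriegerFamily A T) (hA : ∀ i j, A i j = 0 ∨ A i j = 1)
    {N : ℕ} {x : B} (hx : x ∈ hT.core hA N) : π x ∈ (hT.map π).core hA N := by
  replace hx : x ∈ Submodule.span ℂ (matrixUnits T N) := hx
  change π x ∈ Submodule.span ℂ (matrixUnits _ N)
  induction hx using Submodule.span_induction with
  | mem x hx =>
    obtain ⟨i, α, β, hα, hβ, rfl⟩ := hx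
    exact Submodule.subset_span ⟨i, α, β, hα, hβ, by simp [map_word, map_star π]⟩
  | zero => simp
  | add x y _ _ h1 h2 => simpa using add_mem h1 h2
  | smul r x _ h => simpa using Submodule.smul_mem _ _ h

/-- The compression of the core, one component for each of the words `i :: γ i`. -/
noncomputable def coreCompression (hT : IsCuntzKriegerFamily A T) (hA : ∀ i j, A i j = 0 ∨ A i j = 1)
    (γ : I → List I) (N : ℕ) : hT.core hA N →⋆ₙₐ[ℂ] (I → B') where
  toFun x i := π x * compressor (fun i => π (T i)) (i :: γ i) N
  map_smul' r x := by
    ext i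
    simp
  map_zero' := by
    ext i
    simp
  map_add' x y := by
    ext i
    simp [add_mul]
  map_mul' x y := by
    ext i
    have h := (hT.map π).commute_compressor hA i (γ i) (hT.map_mem_core π hA y.2)
    simp only [NonUnitalStarSubalgebra.coe_mul, map_mul, Pi.mul_apply]
    rw [mul_assoc, mul_assoc, ← mul_assoc (compressor _ _ _), ← h.eq, mul_assoc (π _) _ _,
      (hT.map π).compressor_mul_self hA]
  map_star' x := by
    ext i
    have h := (hT.map π).commute_compressor hA i (γ i) (hT.map_mem_core π hA (star x).2)
    simp only [Pi.star_apply, star_mul, star_compressor, h.eq, ← map_star π]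
    rfl

theorem injective_coreCompression (hT : IsCuntzKriegerFamily A T)
    (hA : ∀ i j, A i j = 0 ∨ A i j = 1) (h0 : ∀ i, π (T i) ≠ 0) (γ : I → List I)
    (hγ : ∀ i, (i :: γ i).IsChain fun i j => A i j = 1) (N : ℕ) :
    Function.Injective (coreCompression π hT hA γ N) := by
  rw [injective_iff_map_eq_zero]
  rintro ⟨x, hx⟩ h
  have hR := hT.map π
  set R : I → B' := fun i => π (T i) with hRdef
  have hx0 : ∀ i, π x * compressor R (i :: γ i) N = 0 := fun i => congrFun h i
  refine Subtype.ext (hT.eq_zero_of_corners (N + 1) x fun α' β' hα' hβ' => ?_)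
  obtain rfl | ⟨α, i, rfl⟩ := List.eq_nil_or_concat' α'
  · simp at hα'
  obtain rfl | ⟨β, j, rfl⟩ := List.eq_nil_or_concat' β'
  · simp at hβ'
  have hα : α.length = N := by simpa using hα'
  have hβ : β.length = N := by simpa using hβ'
  obtain ⟨c, hc, hc'⟩ := hT.exists_corner_eq hA hx hα hβ i j
  rw [hc]
  by_cases hij : i = j
  · subst hij
    -- the corner of `π x` at the words `α i γ` and `β i γ` is `c` times a nonzero element
    have h1 : star (word R (γ i)) * π (star (word T (α ++ [i])) * x * word T (β ++ [i])) *
        word R (γ i) = c • (star (word R (i :: γ i)) * word R (i :: γ i)) := by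
      rw [hc]
      simp [hRdef, mul_assoc, map_star π]
    have hw : compressor R (i :: γ i) N * word R β * word R (i :: γ i)
        = word R β * word R (i :: γ i) := by
      rw [← hβ, hR.compressor_mul_word, mul_assoc, wordProj, hR.word_mul_star_mul_word hA]
    have h2 : star (word R (γ i)) * π (star (word T (α ++ [i])) * x * word T (β ++ [i])) *
        word R (γ i) = 0 := by
      calc _ = star (word R (γ i)) * star (word R (α ++ [i])) * π x *
            (word R β * word R (i :: γ i)) := by
              simp only [map_mul, map_star, map_word, word_append, word_cons, word_nil, mul_one,
                mul_assoc, hRdef]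
        _ = 0 := by
              rw [← hw, mul_assoc _ (π x), mul_assoc (compressor _ _ _), ← mul_assoc (π x), hx0,
                zero_mul, mul_zero]
    rw [h1, smul_eq_zero, CStarRing.star_mul_self_eq_zero_iff] at h2
    rcases h2 with h2 | h2
    · simp [h2]
    · exact absurd h2 (hR.word_ne_zero h0 i _ (hγ i))
  · simp [hc' hij]

/-- Condition (I) of Cuntz and Krieger in a finitary form: from every vertex there start paths
without overlaps by at most `K` letters. -/
def ConditionI (A : Matrix I I ℤ) : Prop :=
  ∀ (K : ℕ) (i : I), ∃ γ : List I,
    (i :: γ).IsChain (fun i j => A i j = 1) ∧ NoOverlap K (i :: γ)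

variable {π}

/-- The norm of the component of degree zero is bounded in every representation. -/
theorem norm_degree_zero_le (hT : IsCuntzKriegerFamily A T)
    (hA : ∀ i j, A i j = 0 ∨ A i j = 1) (hI : ConditionI A) (h0 : ∀ i, π (T i) ≠ 0) {K : ℕ}
    {x : ℤ → B} (hx : ∀ k, x k ∈ homogeneous T k) :
    ‖x 0‖ ≤ ‖π (∑ k ∈ Finset.Icc (-K : ℤ) K, x k)‖ := by
  have hR := hT.map π
  choose γ hγ hγ' using hI K
  choose M hM using fun k => hT.mem_homogeneous_iff.1 (hx k)
  set N := (Finset.Icc (-K : ℤ) K).sup M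
  have hN : ∀ k ∈ Finset.Icc (-K : ℤ) K, x k ∈ bihomogeneous T (N + k.toNat) (N + (-k).toNat) :=
    fun k hk => hT.bihomogeneous_monotone k (Finset.le_sup hk) (hM k)
  have hz : (0 : ℤ) ∈ Finset.Icc (-K : ℤ) K := by simp
  have hcore : x 0 ∈ hT.core hA N := hT.bihomogeneous_le_core hA (by simpa using hN 0 hz)
  have : IsClosed (hT.core hA N : Set B) := hT.isClosed_core hA N
  have hiso := NonUnitalStarAlgHom.norm_map (coreCompression π hT hA γ N)
    (hT.injective_coreCompression π hA h0 γ hγ N) ⟨x 0, hcore⟩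
  have hn : ‖x 0‖ = ‖coreCompression π hT hA γ N ⟨x 0, hcore⟩‖ := hiso.symm
  rw [hn]
  refine (pi_norm_le_iff_of_nonneg (norm_nonneg _)).2 fun i => ?_
  set Q := compressor (fun i => π (T i)) (i :: γ i) N
  have hQ : ‖Q‖ ≤ 1 := hR.norm_compressor_le hA i (γ i) N
  have hQc : Commute (π (x 0)) Q := hR.commute_compressor hA i (γ i) (hT.map_mem_core π hA hcore)
  have e : π (x 0) * Q = Q * π (∑ k ∈ Finset.Icc (-K : ℤ) K, x k) * Q := by
    rw [map_sum, Finset.mul_sum, Finset.sum_mul, Finset.sum_eq_single 0]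
    · rw [← hQc.eq, mul_assoc, hR.compressor_mul_self hA]
    · intro k hk hk0
      exact hR.compressor_mul_mul_compressor hA (hγ' i) hk0 hk
        (map_mem_bihomogeneous π (hN k hk))
    · exact fun h => absurd hz h
  change ‖π (x 0) * Q‖ ≤ _
  rw [e]
  calc _ ≤ ‖Q‖ * ‖π (∑ k ∈ Finset.Icc (-K : ℤ) K, x k)‖ * ‖Q‖ :=
        (norm_mul_le _ _).trans (mul_le_mul_of_nonneg_right (norm_mul_le _ _) (norm_nonneg _))
    _ ≤ 1 * ‖π (∑ k ∈ Finset.Icc (-K : ℤ) K, x k)‖ * 1 := by gcongr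
    _ = _ := by simp

/-- On the elements of bounded degree `π` is bounded below, with a constant that is linear in the
degree. -/
theorem norm_le_of_mem_degreeLE (hT : IsCuntzKriegerFamily A T)
    (hA : ∀ i j, A i j = 0 ∨ A i j = 1) (hI : ConditionI A) (h0 : ∀ i, π (T i) ≠ 0) {K : ℕ}
    {y : B} (hy : y ∈ degreeLE T K) : ‖y‖ ≤ (2 * K + 1) * ‖π y‖ := by
  classical
  let _ := CStarAlgebra.spectralOrder B
  have := CStarAlgebra.spectralOrderedRing B
  obtain ⟨a, ha, rfl⟩ := mem_degreeLE_iff.1 hy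
  set s := Finset.Icc (-K : ℤ) K
  set y := ∑ k ∈ s, a k with hydef
  -- the homogeneous components of `y* y`; the one of degree zero is `∑ k, (a k)* (a k)`
  let z : ℤ → B := fun n => ∑ p ∈ s ×ˢ s with p.2 - p.1 = n, star (a p.1) * a p.2
  have hz : ∀ n, z n ∈ homogeneous T n := fun n => by
    refine Submodule.sum_mem _ fun p hp => ?_
    rw [← (Finset.mem_filter.1 hp).2, sub_eq_neg_add]
    exact hT.mul_mem_homogeneous hA (hT.star_mem_homogeneous (ha _)) (ha _)
  have hzsum : ∑ n ∈ Finset.Icc (-(2 * K : ℕ) : ℤ) (2 * K : ℕ), z n = star y * y := by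
    rw [Finset.sum_fiberwise_of_maps_to, hydef, star_sum, Finset.sum_mul_sum, Finset.sum_product]
    intro p hp
    simp only [s, Finset.mem_product, Finset.mem_Icc] at hp ⊢
    push_cast
    omega
  have hz0 : ‖z 0‖ ≤ ‖π y‖ ^ 2 := by
    have h := hT.norm_degree_zero_le (π := π) hA hI h0 (K := 2 * K) hz
    rwa [hzsum, map_mul, map_star, CStarRing.norm_star_mul_self, ← sq] at h
  have hk : ∀ k ∈ s, ‖a k‖ ≤ ‖π y‖ := fun k hk => by
    have h1 : star (a k) * a k ≤ z 0 := by
      refine Finset.single_le_sum (f := fun p : ℤ × ℤ => star (a p.1) * a p.2) (a := (k, k))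
        (fun p hp => ?_) (by simp [hk])
      have : p.2 = p.1 := sub_eq_zero.1 (Finset.mem_filter.1 hp).2
      rw [this]
      exact star_mul_self_nonneg _
    have h2 := (CStarAlgebra.norm_le_norm_of_nonneg_of_le (star_mul_self_nonneg (a k)) h1).trans hz0
    rw [CStarRing.norm_star_mul_self, ← sq] at h2
    exact (sq_le_sq₀ (norm_nonneg _) (norm_nonneg _)).1 h2
  calc ‖y‖ ≤ ∑ k ∈ s, ‖a k‖ := norm_sum_le _ _
    _ ≤ ∑ k ∈ s, ‖π y‖ := Finset.sum_le_sum hk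
    _ = (2 * K + 1) * ‖π y‖ := by
      have hc : ((K : ℤ) + 1 - -K).toNat = 2 * K + 1 := by omega
      rw [Finset.sum_const, Int.card_Icc, hc, nsmul_eq_mul]
      push_cast
      ring

theorem _root_.le_of_forall_pow_two_pow_le {a b C : ℝ} (hb : 0 ≤ b)
    (h : ∀ n : ℕ, a ^ 2 ^ n ≤ (C * 2 ^ n + 1) * b ^ 2 ^ n) : a ≤ b := by
  by_contra! hab
  rcases hb.eq_or_lt with rfl | hb
  · have := h 0
    simp at this
    linarith
  have hr : 1 < a / b := (one_lt_div hb).2 hab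
  -- a geometric sequence with ratio greater than one outgrows a linear one
  have ht : Filter.Tendsto (fun k : ℕ => ((k : ℝ) ^ 1) / (a / b) ^ k) Filter.atTop (nhds 0) :=
    tendsto_pow_const_div_const_pow_of_one_lt 1 hr
  have ht' : Filter.Tendsto (fun k : ℕ => 1 / (a / b) ^ k) Filter.atTop (nhds 0) := by
    simpa using tendsto_pow_const_div_const_pow_of_one_lt 0 hr
  have h2 : Filter.Tendsto (fun n : ℕ => 2 ^ n) Filter.atTop Filter.atTop :=
    tendsto_pow_atTop_atTop_of_one_lt (r := (2 : ℕ)) (by norm_num)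
  have ht2 := (((ht.const_mul C).add ht').comp h2)
  rw [mul_zero, add_zero] at ht2
  obtain ⟨n, hn⟩ := (ht2.eventually_lt_const (zero_lt_one' ℝ)).exists
  have hp : 0 < (a / b) ^ 2 ^ n := by positivity
  simp only [Function.comp_apply, pow_one, Nat.cast_pow, Nat.cast_ofNat] at hn
  rw [← mul_div_assoc, ← add_div, div_lt_one hp, div_pow, lt_div_iff₀ (by positivity)] at hn
  exact absurd (h n) (not_le.2 hn)

/-- **Cuntz–Krieger uniqueness theorem**: a `*`-homomorphism that does not annihilate the
generators is isometric on the `*`-algebra that they generate. -/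
theorem norm_map_of_mem_adjoin (hT : IsCuntzKriegerFamily A T)
    (hA : ∀ i j, A i j = 0 ∨ A i j = 1) (hI : ConditionI A) (h0 : ∀ i, π (T i) ≠ 0) {y : B}
    (hy : y ∈ StarAlgebra.adjoin ℂ (Set.range T)) : ‖π y‖ = ‖y‖ := by
  refine le_antisymm (NonUnitalStarAlgHom.norm_apply_le π y) ?_
  obtain ⟨K, hK⟩ := hT.exists_mem_degreeLE hA hy
  have hK' := hT.mul_mem_degreeLE hA (hT.star_mem_degreeLE hK) hK
  -- the constant of the lower bound disappears upon passing to the powers of `y* y`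
  have h : ‖star y * y‖ ≤ ‖π (star y * y)‖ := by
    refine le_of_forall_pow_two_pow_le (C := 2 * (K + K : ℕ)) (norm_nonneg _)
      fun n => ?_
    have h := hT.norm_le_of_mem_degreeLE (π := π) hA hI h0 (hT.pow_mem_degreeLE hA hK' (2 ^ n))
    rw [map_pow, (IsSelfAdjoint.star_mul_self y).norm_pow_two_pow,
      ((IsSelfAdjoint.star_mul_self y).map π).norm_pow_two_pow] at h
    refine h.trans_eq ?_
    push_cast
    ring
  rw [map_mul, map_star, CStarRing.norm_star_mul_self, CStarRing.norm_star_mul_self] at h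
  exact (mul_self_le_mul_self_iff (norm_nonneg _) (norm_nonneg _)).2 h

end Uniqueness

end IsCuntzKriegerFamily

/-! ### Irreducible matrices that are not permutation matrices -/

section Graph

variable {I : Type*}

namespace Matrix.IsIrreducible

variable {A : Matrix I I ℤ}

theorem transGen (hirr : A.IsIrreducible) (hA : ∀ i j, A i j = 0 ∨ A i j = 1) (i j : I) :
    Relation.TransGen (fun i j => A i j = 1) i j := by
  let _ : Quiver I := A.toQuiver
  have hedge {i j : I} (e : i ⟶ j) : A i j = 1 :=
    (hA i j).resolve_left fun h => absurd e.down (by simp [h])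
  have hpath (i j : I) (p : Quiver.Path i j) :
      Relation.ReflTransGen (fun i j => A i j = 1) i j := by
    induction p with
    | nil => exact .refl
    | cons p e ih => exact ih.tail (hedge e)
  obtain ⟨p, hp⟩ := hirr.connected i j
  cases p with
  | nil => simp at hp
  | cons p e => exact .tail' (hpath _ _ p) (hedge e)

/-- Some vertex of the graph has two outgoing edges. -/
theorem exists_branching [Finite I] [DecidableEq I] (hirr : A.IsIrreducible)
    (hA : ∀ i j, A i j = 0 ∨ A i j = 1) (hperm : ∀ σ : Equiv.Perm I, A ≠ σ.permMatrix ℤ) :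
    ∃ v a b, a ≠ b ∧ A v a = 1 ∧ A v b = 1 := by
  by_contra! h
  have hrow (i : I) : ∃ j, A i j = 1 := by
    obtain ⟨j, hj, _⟩ := Relation.TransGen.head'_iff.1 (hirr.transGen hA i i)
    exact ⟨j, hj⟩
  choose f hf using hrow
  have huniq (i j : I) (hij : A i j = 1) : f i = j := by
    by_contra hne
    exact h i (f i) j hne (hf i) hij
  have hsurj : Function.Surjective f := fun j => by
    obtain ⟨b, _, hb⟩ := Relation.TransGen.tail'_iff.1 (hirr.transGen hA j j)
    exact ⟨b, huniq b j hb⟩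
  refine hperm (Equiv.ofBijective f ⟨Finite.injective_iff_surjective.2 hsurj, hsurj⟩) ?_
  ext i j
  have e : Equiv.Perm.permMatrix ℤ
      (Equiv.ofBijective f ⟨Finite.injective_iff_surjective.2 hsurj, hsurj⟩) i j
      = if f i = j then 1 else 0 := by
    rw [Equiv.Perm.permMatrix, PEquiv.toMatrix_apply]
    simp only [Equiv.toPEquiv_apply, Option.mem_some_iff]
    rfl
  rw [e]
  split_ifs with hij
  · exact hij ▸ hf i
  · exact (hA i j).resolve_right fun h1 => hij (huniq i j h1)

theorem exists_long_path (hirr : A.IsIrreducible) (hA : ∀ i j, A i j = 0 ∨ A i j = 1)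
    (n : ℕ) (i v : I) :
    ∃ l : List I, n ≤ l.length ∧ ((i :: l).IsChain fun i j => A i j = 1) ∧
      v ∈ (i :: l).getLast? := by
  induction n generalizing i with
  | zero =>
    have h := (hirr.transGen hA i v).to_reflTransGen
    induction h using Relation.ReflTransGen.head_induction_on with
    | refl => exact ⟨[], le_rfl, List.isChain_singleton _, by simp⟩
    | head h _ ih =>
      obtain ⟨l, _, hl, hv⟩ := ih
      exact ⟨_ :: l, by simp, List.isChain_cons_cons.2 ⟨h, hl⟩, by simpa using hv⟩
  | succ n ih =>
    obtain ⟨j, hj, _⟩ := Relation.TransGen.head'_iff.1 (hirr.transGen hA i i)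
    obtain ⟨l, hn, hl, hv⟩ := ih j
    exact ⟨j :: l, by simpa using hn, List.isChain_cons_cons.2 ⟨hj, hl⟩, by simpa using hv⟩

end Matrix.IsIrreducible

namespace IsCuntzKriegerFamily

theorem getElem?_eq_of_prefix {γ δ : List I} (h : γ <+: δ ++ γ) {n : ℕ} (h1 : δ.length ≤ n)
    (h2 : n < γ.length) : γ[n]? = γ[n - δ.length]? := by
  obtain ⟨t, ht⟩ := h
  rw [← List.getElem?_append_right h1, ← ht, List.getElem?_append_left h2]

/-- Two words that differ only in the last letter cannot both have a period that is at most
half their length: the two periods of the common part would yield the same next letter. -/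
theorem noOverlap_or {K : ℕ} {u : List I} (hu : 2 * K ≤ u.length) {a b : I} (hab : a ≠ b) :
    NoOverlap K (u ++ [a]) ∨ NoOverlap K (u ++ [b]) := by
  by_contra! h
  simp only [NoOverlap, not_forall, not_not] at h
  obtain ⟨⟨δ, hδ, hδK, h1⟩, ⟨ε, hε, hεK, h2⟩⟩ := h
  have per {a : I} {δ : List I} (hδ : 1 ≤ δ.length) (h1 : u ++ [a] <+: δ ++ (u ++ [a])) {n : ℕ}
      (h : δ.length ≤ n) (hn : n < u.length) : u[n]? = u[n - δ.length]? := by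
    have := getElem?_eq_of_prefix h1 h (by simp; omega)
    rwa [List.getElem?_append_left hn, List.getElem?_append_left (by omega)] at this
  have next {a : I} {δ : List I} (hδ : 1 ≤ δ.length) (hδK : δ.length ≤ K)
      (h1 : u ++ [a] <+: δ ++ (u ++ [a])) : some a = u[u.length - δ.length]? := by
    have := getElem?_eq_of_prefix h1 (n := u.length) (by omega) (by simp)
    rwa [List.getElem?_concat_length, List.getElem?_append_left (by omega)] at this
  have ha := next hδ hδK h1
  have hb := next hε hεK h2
  rw [per hε h2 (by omega) (by omega), Nat.sub_right_comm] at ha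
  rw [per hδ h1 (by omega) (by omega)] at hb
  exact hab (Option.some_injective _ (ha.trans hb.symm))

theorem conditionI [Finite I] [DecidableEq I] {A : Matrix I I ℤ} (hirr : A.IsIrreducible)
    (hA : ∀ i j, A i j = 0 ∨ A i j = 1) (hperm : ∀ σ : Equiv.Perm I, A ≠ σ.permMatrix ℤ) :
    ConditionI A := by
  intro K i
  obtain ⟨v, a, b, hab, ha, hb⟩ := hirr.exists_branching hA hperm
  obtain ⟨l, hl, hc, hv⟩ := hirr.exists_long_path hA (2 * K) i v
  have hext (c : I) (hvc : A v c = 1) : (i :: (l ++ [c])).IsChain fun i j => A i j = 1 := by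
    rw [← List.cons_append]
    refine hc.append (List.isChain_singleton _) fun x hx y hy => ?_
    obtain rfl : x = v := Option.mem_unique hx hv
    obtain rfl : c = y := by simpa using hy
    exact hvc
  rcases noOverlap_or (K := K) (u := i :: l) (by simp; omega) hab with h | h
  · exact ⟨l ++ [a], hext a ha, h⟩
  · exact ⟨l ++ [b], hext b hb, h⟩

end IsCuntzKriegerFamily

end Graph

namespace IsCuntzKriegerFamily

variable {I : Type*} [Fintype I] {A : Matrix I I ℤ}

/-- For an irreducible matrix no generator vanishes, unless the algebra is zero. -/
theorem ne_zero {B : Type*} [CStarAlgebra B] [Nontrivial B] {T : I → B}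
    (hT : IsCuntzKriegerFamily A T) (hirr : A.IsIrreducible)
    (hA : ∀ i j, A i j = 0 ∨ A i j = 1) (i : I) : T i ≠ 0 := by
  intro hi
  have hstep (k j : I) (hkj : A k j = 1) (hk : T k = 0) : T j = 0 := by
    have h := hT.source_mul k j
    rwa [hk, mul_zero, zero_mul, hkj, one_smul, eq_comm] at h
  have hall (j : I) : T j = 0 := by
    have h := (hirr.transGen hA i j).to_reflTransGen
    induction h with
    | refl => exact hi
    | tail _ h ih => exact hstep _ _ h ih
  have h1 := hT.sum_range
  simp [hall] at h1

/-- A Cuntz–Krieger family for an irreducible matrix that is not a permutation matrix does not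
live on a finite-dimensional space: with `r i` the rank of `T i`, one has `r i = ∑ j, A i j * r j`,
and summing over `i` shows that all columns of `A` have sum one, while some column has two entries. -/
theorem not_finiteDimensional [DecidableEq I] {H : Type*} [NormedAddCommGroup H]
    [InnerProductSpace ℂ H] [CompleteSpace H] [Nontrivial H] {T : I → (H →L[ℂ] H)}
    (hT : IsCuntzKriegerFamily A T) (hirr : A.IsIrreducible)
    (hA : ∀ i j, A i j = 0 ∨ A i j = 1) (hperm : ∀ σ : Equiv.Perm I, A ≠ σ.permMatrix ℤ) :
    ¬ FiniteDimensional ℂ H := by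
  intro hfin
  let b := stdOrthonormalBasis ℂ H
  -- the trace of `(T i)* T i`, as a real number
  let r : I → ℝ := fun i => ∑ k, ‖T i (b k)‖ ^ 2
  have hr (i : I) : LinearMap.trace ℂ H (star (T i) * T i : H →L[ℂ] H).toLinearMap = r i := by
    rw [LinearMap.trace_eq_sum_inner _ b]
    simp only [r, Complex.ofReal_sum]
    refine Finset.sum_congr rfl fun k _ => ?_
    simp [ContinuousLinearMap.star_eq_adjoint, ContinuousLinearMap.adjoint_inner_right,
      inner_self_eq_norm_sq_to_K]
  have hr' (i : I) : LinearMap.trace ℂ H (T i * star (T i) : H →L[ℂ] H).toLinearMap = r i := by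
    rw [← hr]
    exact LinearMap.trace_mul_comm ℂ (T i).toLinearMap (star (T i)).toLinearMap
  have hpos (i : I) : 0 < r i := by
    have hne := hT.ne_zero hirr hA i
    refine (Finset.sum_nonneg fun k _ => by positivity).lt_of_ne fun h => hne ?_
    rw [eq_comm, Finset.sum_eq_zero_iff_of_nonneg fun k _ => by positivity] at h
    refine ContinuousLinearMap.coe_injective (b.toBasis.ext fun k => ?_)
    simpa using h k (Finset.mem_univ k)
  have hsum (i : I) : r i = ∑ j, (A i j : ℝ) * r j := by
    have h := congrArg (fun S : H →L[ℂ] H => LinearMap.trace ℂ H S.toLinearMap) (hT.source i)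
    simp only [ContinuousLinearMap.toLinearMap_sum, map_sum] at h
    rw [hr] at h
    have h2 (j : I) : LinearMap.trace ℂ H (A i j • (T j * star (T j)) : H →L[ℂ] H).toLinearMap
        = ((A i j : ℝ) * r j : ℝ) := by
      rcases hA i j with h | h
      · simp [h]
      · simp only [h, one_smul, hr', Int.cast_one, one_mul]
    simp only [h2] at h
    exact_mod_cast h
  -- some column of `A` has two entries, and no column is zero
  obtain ⟨v, a, c, hac, ha, hc⟩ := hirr.transpose.exists_branching (fun i j => hA j i) fun σ h =>
    hperm σ⁻¹ (by rw [← Matrix.transpose_permMatrix, ← h, Matrix.transpose_transpose])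
  have hcol (j : I) : ∃ i, A i j = 1 := by
    obtain ⟨i, _, hi⟩ := Relation.TransGen.tail'_iff.1 (hirr.transGen hA j j)
    exact ⟨i, hi⟩
  have hA0 (i j : I) : (0 : ℝ) ≤ A i j := by rcases hA i j with h | h <;> simp [h]
  have hle (j : I) : r j ≤ ∑ i, (A i j : ℝ) * r j := by
    obtain ⟨i, hi⟩ := hcol j
    have := Finset.single_le_sum (f := fun i => (A i j : ℝ) * r j)
      (fun i _ => mul_nonneg (hA0 i j) (hpos j).le) (Finset.mem_univ i)
    simpa [hi] using this
  have hlt : r v < ∑ i, (A i v : ℝ) * r v := by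
    have := Finset.sum_le_sum_of_subset_of_nonneg (f := fun i => (A i v : ℝ) * r v)
      (Finset.subset_univ {a, c}) fun i _ _ => mul_nonneg (hA0 i v) (hpos v).le
    rw [Finset.sum_pair hac] at this
    simp only [Matrix.transpose_apply] at ha hc
    simp only [ha, hc, Int.cast_one, one_mul] at this
    linarith [hpos v]
  have h := Finset.sum_lt_sum (fun j _ => hle j) ⟨v, Finset.mem_univ v, hlt⟩
  refine lt_irrefl (∑ i, r i) (h.trans_eq ?_)
  rw [Finset.sum_comm]
  exact (Finset.sum_congr rfl fun i _ => hsum i).symm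

end IsCuntzKriegerFamily

namespace MarkovFibredSystem

/-! ### The operators of a Markov fibred system -/

variable {Ω : Type*} [MeasurableSpace Ω] {m : Measure Ω} {I : Type*}

theorem subset_or_disjoint (X : MarkovFibredSystem Ω m I) {E : Set Ω}
    (hE : MeasurableSet[MeasurableSpace.generateFrom (Set.range X.a)] E) (j : I) :
    X.a j ⊆ E ∨ Disjoint (X.a j) E := by
  induction E, hE using MeasurableSpace.generateFrom_induction with
  | hC E hE _ =>
    obtain ⟨k, rfl⟩ := hE
    by_cases h : j = k
    · exact Or.inl (h ▸ subset_rfl)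
    · exact Or.inr (X.disjoint_a h)
  | empty => exact Or.inr (Set.disjoint_empty _)
  | compl E _ h =>
    rcases h with h | h
    · exact Or.inr (Set.disjoint_compl_right_iff_subset.2 h)
    · exact Or.inl (Set.subset_compl_iff_disjoint_right.2 h)
  | iUnion f _ h =>
    by_cases h' : ∃ n, X.a j ⊆ f n
    · obtain ⟨n, hn⟩ := h'
      exact Or.inl (hn.trans (Set.subset_iUnion f n))
    · push Not at h'
      exact Or.inr (Set.disjoint_iUnion_right.2 fun n => (h n).resolve_left (h' n))

theorem incidence_eq_zero_or_one (X : MarkovFibredSystem Ω m I) (i j : I) :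
    X.incidence i j = 0 ∨ X.incidence i j = 1 := by
  unfold incidence
  split_ifs <;> simp

theorem indicator_image_eq_sum [Fintype I] (X : MarkovFibredSystem Ω m I) (i : I) (f : Ω → ℂ)
    (x : Ω) :
    (X.θ '' X.a i).indicator f x = ∑ j, X.incidence i j • (X.a j).indicator f x := by
  obtain ⟨k, hk⟩ : ∃ k, x ∈ X.a k := Set.mem_iUnion.1 (X.iUnion_a ▸ Set.mem_univ x)
  rw [Finset.sum_eq_single k]
  · rcases X.subset_or_disjoint (X.markov i) k with h | h
    · simp [incidence, h, hk, h hk]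
    · have hx : x ∉ X.θ '' X.a i := Set.disjoint_left.1 h hk
      have h' : ¬ X.a k ⊆ X.θ '' X.a i := fun h => hx (h hk)
      simp [incidence, h', Set.indicator_of_notMem hx]
  · intro j _ hj
    rw [Set.indicator_of_notMem (Set.disjoint_left.1 (X.disjoint_a hj.symm) hk), smul_zero]
  · simp

theorem sum_indicator_eq [Fintype I] (X : MarkovFibredSystem Ω m I) (f : Ω → ℂ) (x : Ω) :
    ∑ j, (X.a j).indicator f x = f x := by
  obtain ⟨k, hk⟩ : ∃ k, x ∈ X.a k := Set.mem_iUnion.1 (X.iUnion_a ▸ Set.mem_univ x)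
  rw [Finset.sum_eq_single k, Set.indicator_of_mem hk]
  · intro j _ hj
    exact Set.indicator_of_notMem (Set.disjoint_left.1 (X.disjoint_a hj.symm) hk) _
  · simp

/-- The restriction `1_E f` of a square integrable function to a measurable set. -/
noncomputable def cut {E : Set Ω} (hE : MeasurableSet E) (f : Lp ℂ 2 m) : Lp ℂ 2 m :=
  ((Lp.memLp f).indicator hE).toLp _

theorem cut_apply {E : Set Ω} (hE : MeasurableSet E) (f : Lp ℂ 2 m) :
    cut hE f =ᵐ[m] E.indicator f :=
  ((Lp.memLp f).indicator hE).coeFn_toLp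

theorem inner_cut {E : Set Ω} (hE : MeasurableSet E) (f g : Lp ℂ 2 m) :
    inner ℂ (cut hE f) g = ∫ x in E, inner ℂ (f x) (g x) ∂m := by
  rw [L2.inner_def, ← integral_indicator hE]
  refine integral_congr_ae ?_
  filter_upwards [cut_apply hE f] with x hx
  rw [hx]
  by_cases h : x ∈ E <;> simp [h]

theorem inner_cut_comm {E : Set Ω} (hE : MeasurableSet E) (f g : Lp ℂ 2 m) :
    inner ℂ (cut hE f) g = inner ℂ f (cut hE g) := by
  rw [inner_cut, L2.inner_def, ← integral_indicator hE]
  refine integral_congr_ae ?_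
  filter_upwards [cut_apply hE g] with x hx
  rw [hx]
  by_cases h : x ∈ E <;> simp [h]

section Polish

variable [TopologicalSpace Ω] [PolishSpace Ω] [BorelSpace Ω]

theorem measurableSet_image (X : MarkovFibredSystem Ω m I) (i : I) {E : Set Ω}
    (hE : MeasurableSet E) : MeasurableSet (X.θ '' (E ∩ X.a i)) := by
  have h := (X.measurableEmbedding_restrict i).measurableSet_image.2
    (measurable_subtype_coe hE : MeasurableSet ((Subtype.val : X.a i → Ω) ⁻¹' E))
  convert h using 1
  ext y
  simp only [Set.mem_image, Set.mem_preimage, Subtype.exists, Set.domRestrict_apply,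
    Set.mem_inter_iff]
  exact ⟨fun ⟨x, ⟨h, hx⟩, e⟩ => ⟨x, hx, h, e⟩, fun ⟨x, hx, h, e⟩ => ⟨x, ⟨h, hx⟩, e⟩⟩

theorem measurableSet_image_a (X : MarkovFibredSystem Ω m I) (i : I) :
    MeasurableSet (X.θ '' X.a i) := by
  simpa using X.measurableSet_image i MeasurableSet.univ

theorem map_restrict_imageMeasure (X : MarkovFibredSystem Ω m I) (i : I) :
    (X.imageMeasure.restrict (X.a i)).map X.θ = m.restrict (X.θ '' X.a i) := by
  ext E hE
  rw [Measure.map_apply X.measurable_θ hE, Measure.restrict_apply (X.measurable_θ hE),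
    X.imageMeasure_apply ((X.measurable_θ hE).inter (X.measurableSet_a i)), tsum_eq_single i,
    Measure.restrict_apply hE, Set.inter_assoc, Set.inter_self, Set.inter_comm,
    Set.image_inter_preimage, Set.inter_comm]
  intro j hj
  rw [Set.inter_assoc, (X.disjoint_a hj.symm).inter_eq]
  simp

variable [IsFiniteMeasure m] [Fintype I]

theorem isFiniteMeasure_imageMeasure (X : MarkovFibredSystem Ω m I) :
    IsFiniteMeasure X.imageMeasure := by
  refine ⟨?_⟩
  rw [X.imageMeasure_apply MeasurableSet.univ, tsum_fintype]
  exact ENNReal.sum_lt_top.2 fun i _ => measure_lt_top _ _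

theorem withDensity_density (X : MarkovFibredSystem Ω m I) :
    m.withDensity X.density = X.imageMeasure :=
  have := X.isFiniteMeasure_imageMeasure
  Measure.withDensity_rnDeriv_eq _ _ X.imageMeasure_absolutelyContinuous

omit [TopologicalSpace Ω] [PolishSpace Ω] [BorelSpace Ω] [IsFiniteMeasure m] [Fintype I] in
theorem measurable_density (X : MarkovFibredSystem Ω m I) : Measurable X.density :=
  Measure.measurable_rnDeriv _ _

theorem density_lt_top (X : MarkovFibredSystem Ω m I) : ∀ᵐ x ∂m, X.density x < ∞ :=
  have := X.isFiniteMeasure_imageMeasure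
  Measure.rnDeriv_lt_top _ _

/-- The density does not vanish since `θ` is non-singular in both directions. -/
theorem density_ne_zero (X : MarkovFibredSystem Ω m I) : ∀ᵐ x ∂m, X.density x ≠ 0 := by
  have hZ : MeasurableSet {x | X.density x = 0} :=
    X.measurable_density (measurableSet_singleton 0)
  have h0 : X.imageMeasure {x | X.density x = 0} = 0 := by
    rw [← X.withDensity_density, withDensity_apply _ hZ]
    exact setLIntegral_eq_zero hZ fun x hx => hx
  rw [X.imageMeasure_apply hZ, ENNReal.tsum_eq_zero] at h0
  have h1 : {x | X.density x = 0} = ⋃ i, {x | X.density x = 0} ∩ X.a i := by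
    rw [← Set.inter_iUnion, X.iUnion_a, Set.inter_univ]
  rw [ae_iff]
  simp only [ne_eq, not_not]
  rw [h1, measure_iUnion_null_iff]
  exact fun i => (X.nonsingular i _ (hZ.inter (X.measurableSet_a i)) Set.inter_subset_right).1
    (h0 i)

/-- Change of variables on one atom of the partition. -/
theorem setIntegral_density_smul (X : MarkovFibredSystem Ω m I) (i : I) {g : Ω → ℂ}
    (hg : AEStronglyMeasurable g m) :
    ∫ x in X.a i, (X.density x).toReal • g (X.θ x) ∂m = ∫ y in X.θ '' X.a i, g y ∂m := by
  rw [← setIntegral_withDensity_eq_setIntegral_toReal_smul X.measurable_density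
    (ae_restrict_of_ae X.density_lt_top) (fun x => g (X.θ x)) (X.measurableSet_a i),
    X.withDensity_density, ← X.map_restrict_imageMeasure i,
    integral_map X.measurable_θ.aemeasurable]
  rw [X.map_restrict_imageMeasure]
  exact hg.restrict

theorem inner_s_s (X : MarkovFibredSystem Ω m I) (i : I) (f g : Lp ℂ 2 m) :
    inner ℂ (X.s i f) (X.s i g) = inner ℂ (cut (X.measurableSet_image_a i) f) g := by
  rw [inner_cut, ← X.setIntegral_density_smul i (L2.integrable_inner f g).aestronglyMeasurable,
    ← integral_indicator (X.measurableSet_a i), L2.inner_def]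
  refine integral_congr_ae ?_
  filter_upwards [X.s_apply i f, X.s_apply i g] with x hf hg
  rw [hf, hg]
  by_cases h : x ∈ X.a i
  · have hsq : ((√(X.density x).toReal : ℝ) : ℂ) * (√(X.density x).toReal : ℝ)
        = (X.density x).toReal := by
      rw [← Complex.ofReal_mul, Real.mul_self_sqrt ENNReal.toReal_nonneg]
    simp only [rnFun, Set.indicator_of_mem h, RCLike.inner_apply, map_mul, Complex.conj_ofReal,
      Complex.real_smul, ← hsq]
    ring
  · simp [rnFun, h]

theorem star_s_s (X : MarkovFibredSystem Ω m I) (i : I) (f : Lp ℂ 2 m) :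
    star (X.s i) (X.s i f) = cut (X.measurableSet_image_a i) f := by
  refine ext_inner_right ℂ fun g => ?_
  rw [ContinuousLinearMap.star_eq_adjoint, ContinuousLinearMap.adjoint_inner_left, X.inner_s_s]

theorem s_cut (X : MarkovFibredSystem Ω m I) (i : I) (f : Lp ℂ 2 m) :
    X.s i (cut (X.measurableSet_image_a i) f) = X.s i f := by
  refine Lp.ext ?_
  filter_upwards [X.s_apply i f, X.s_apply i (cut (X.measurableSet_image_a i) f),
    X.quasi.ae_eq_comp (cut_apply (X.measurableSet_image_a i) f)] with x h1 h2 h3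
  rw [h1, h2]
  by_cases h : x ∈ X.a i
  · have h3' : cut (X.measurableSet_image_a i) f (X.θ x) = f (X.θ x) :=
      h3.trans (Set.indicator_of_mem (Set.mem_image_of_mem _ h) _)
    simp only [rnFun, Set.indicator_of_mem h, h3']
  · simp [rnFun, h]

theorem cut_s (X : MarkovFibredSystem Ω m I) (i : I) (f : Lp ℂ 2 m) :
    cut (X.measurableSet_a i) (X.s i f) = X.s i f := by
  refine Lp.ext ?_
  filter_upwards [X.s_apply i f, cut_apply (X.measurableSet_a i) (X.s i f)] with x h1 h2
  rw [h2]
  by_cases h : x ∈ X.a i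
  · rw [Set.indicator_of_mem h]
  · rw [Set.indicator_of_notMem h, h1]
    simp [rnFun, h]

theorem star_s_cut (X : MarkovFibredSystem Ω m I) (i : I) (g : Lp ℂ 2 m) :
    star (X.s i) (cut (X.measurableSet_a i) g) = star (X.s i) g := by
  refine ext_inner_right ℂ fun f => ?_
  rw [ContinuousLinearMap.star_eq_adjoint, ContinuousLinearMap.adjoint_inner_left,
    ContinuousLinearMap.adjoint_inner_left, inner_cut_comm, X.cut_s]

/-- The range of `s i` is dense in the functions supported on `a i`: a function `g` in its
orthogonal complement satisfies `∫ x in E ∩ a i, √(dm∘θ/dm) g = 0` for all Borel sets `E`, as is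
seen by testing it on the image of the indicator function of `θ (E ∩ a i)`. -/
theorem eq_zero_of_star_s_eq_zero (X : MarkovFibredSystem Ω m I) (i : I) {g : Lp ℂ 2 m}
    (h0 : star (X.s i) g = 0) (hg : cut (X.measurableSet_a i) g = g) : g = 0 := by
  have horth (f : Lp ℂ 2 m) : inner ℂ (X.s i f) g = 0 := by
    rw [← ContinuousLinearMap.adjoint_inner_right, ← ContinuousLinearMap.star_eq_adjoint, h0,
      inner_zero_right]
  have h1 (F : Set Ω) (hF : MeasurableSet F) : ∀ᵐ x ∂m, X.s i (indicatorConstLp 2 hF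
      (measure_ne_top m F) (1 : ℂ)) x
        = (X.a i).indicator (fun x => (√(X.density x).toReal : ℂ) * F.indicator 1 (X.θ x)) x := by
    filter_upwards [X.s_apply i (indicatorConstLp 2 hF (measure_ne_top m F) (1 : ℂ)),
      X.quasi.ae_eq_comp (indicatorConstLp_coeFn (p := 2) (hs := hF)
        (hμs := measure_ne_top m F) (c := (1 : ℂ)))] with x hx hx'
    rw [hx]
    have hx'' : indicatorConstLp 2 hF (measure_ne_top m F) (1 : ℂ) (X.θ x)
      = F.indicator 1 (X.θ x) := hx'
    simp only [rnFun, Set.indicator, hx'']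
  have hk : (fun x => inner ℂ (X.s i (indicatorConstLp 2 MeasurableSet.univ
      (measure_ne_top m Set.univ) (1 : ℂ)) x) (g x)) =ᵐ[m] 0 := by
    refine (L2.integrable_inner _ g).ae_eq_zero_of_forall_setIntegral_eq_zero fun E hE _ => ?_
    rw [← horth (indicatorConstLp 2 (X.measurableSet_image i hE) (measure_ne_top m _) (1 : ℂ)),
      L2.inner_def, ← integral_indicator hE]
    refine integral_congr_ae ?_
    filter_upwards [h1 _ MeasurableSet.univ, h1 _ (X.measurableSet_image i hE)] with x hx hx'
    rw [hx']
    by_cases ha : x ∈ X.a i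
    · by_cases hxE : x ∈ E
      · have : X.θ x ∈ X.θ '' (E ∩ X.a i) := ⟨x, ⟨hxE, ha⟩, rfl⟩
        rw [Set.indicator_of_mem hxE, hx]
        simp [ha, this]
      · have : X.θ x ∉ X.θ '' (E ∩ X.a i) := by
          rintro ⟨y, ⟨hyE, hya⟩, e⟩
          exact hxE (X.injOn_θ i hya ha e ▸ hyE)
        simp [hxE, this]
    · by_cases hxE : x ∈ E
      · rw [Set.indicator_of_mem hxE, hx]
        simp [ha]
      · simp [hxE, ha]
  refine Lp.ext ?_
  have hg' := cut_apply (X.measurableSet_a i) g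
  rw [hg] at hg'
  filter_upwards [hk, h1 _ MeasurableSet.univ, hg', X.density_ne_zero, X.density_lt_top,
    Lp.coeFn_zero ℂ 2 m] with x hx hx' hgx hd hd' h0
  rw [h0, Pi.zero_apply]
  by_cases ha : x ∈ X.a i
  · have hpos : √(X.density x).toReal ≠ 0 := (Real.sqrt_pos.2 (ENNReal.toReal_pos hd hd'.ne)).ne'
    rw [hx'] at hx
    simpa [ha, hpos] using hx
  · rw [hgx, Set.indicator_of_notMem ha]

theorem s_star_s (X : MarkovFibredSystem Ω m I) (i : I) (f : Lp ℂ 2 m) :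
    X.s i (star (X.s i) f) = cut (X.measurableSet_a i) f := by
  have hadd (f g : Lp ℂ 2 m) : cut (X.measurableSet_a i) (f - g)
      = cut (X.measurableSet_a i) f - cut (X.measurableSet_a i) g :=
    ext_inner_right ℂ fun h => by simp only [inner_cut_comm, inner_sub_left]
  have hidem : cut (X.measurableSet_a i) (cut (X.measurableSet_a i) f)
      = cut (X.measurableSet_a i) f := by
    refine Lp.ext ?_
    filter_upwards [cut_apply (X.measurableSet_a i) (cut (X.measurableSet_a i) f),
      cut_apply (X.measurableSet_a i) f] with x h1 h2
    by_cases h : x ∈ X.a i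
    · rw [h1, Set.indicator_of_mem h]
    · rw [h1, h2, Set.indicator_of_notMem h, Set.indicator_of_notMem h]
  have hps : star (X.s i) (X.s i (star (X.s i) f)) = star (X.s i) f := by
    refine ext_inner_right ℂ fun g => ?_
    rw [X.star_s_s, inner_cut_comm, ContinuousLinearMap.star_eq_adjoint,
      ContinuousLinearMap.adjoint_inner_left, ContinuousLinearMap.adjoint_inner_left, X.s_cut]
  rw [eq_comm, ← sub_eq_zero]
  refine X.eq_zero_of_star_s_eq_zero i ?_ ?_
  · rw [map_sub, X.star_s_cut, hps, sub_self]
  · rw [hadd, hidem, X.cut_s]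

/-- The operators of a Markov fibred system form a Cuntz–Krieger family for its incidence
matrix. -/
theorem isCuntzKriegerFamily_s (X : MarkovFibredSystem Ω m I) :
    IsCuntzKriegerFamily X.incidence X.s where
  partial_isometry i := by
    ext1 f
    change X.s i (star (X.s i) (X.s i f)) = X.s i f
    rw [X.star_s_s, X.s_cut]
  sum_range := by
    ext1 f
    rw [sum_apply]
    change ∑ i, X.s i (star (X.s i) f) = f
    simp only [X.s_star_s]
    refine Lp.ext ?_
    have h (i : I) := cut_apply (X.measurableSet_a i) f
    filter_upwards [ae_all_iff.2 h, Lp.coeFn_finsetSum Finset.univ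
      fun i => cut (X.measurableSet_a i) f] with x hx hs
    rw [hs, Finset.sum_apply, ← X.sum_indicator_eq f x]
    exact Finset.sum_congr rfl fun i _ => hx i
  source i := by
    ext1 f
    rw [sum_apply]
    change star (X.s i) (X.s i f) = ∑ j, X.incidence i j • X.s j (star (X.s j) f)
    simp only [X.s_star_s, X.star_s_s]
    refine Lp.ext ?_
    have h (i : I) := cut_apply (X.measurableSet_a i) f
    have hz (j : I) : ∀ᵐ x ∂m, (X.incidence i j • cut (X.measurableSet_a j) f : Lp ℂ 2 m) x
        = X.incidence i j • cut (X.measurableSet_a j) f x := by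
      rcases X.incidence_eq_zero_or_one i j with h | h
      · filter_upwards [Lp.coeFn_zero ℂ 2 m] with x hx
        simp only [h, zero_smul, hx, Pi.zero_apply]
      · simp only [h, one_smul, Filter.eventually_true]
    filter_upwards [ae_all_iff.2 h, ae_all_iff.2 hz, Lp.coeFn_finsetSum Finset.univ
      fun j => X.incidence i j • cut (X.measurableSet_a j) f,
      cut_apply (X.measurableSet_image_a i) f] with x hx hx' hs hθ
    rw [hs, hθ, Finset.sum_apply, X.indicator_image_eq_sum]
    exact Finset.sum_congr rfl fun j _ => by rw [hx', hx]

end Polish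

end MarkovFibredSystem

/-! ### Passage to the closures, and the representation on `L²` -/

theorem Orthonormal.countable_of_separable {ι H : Type*} [NormedAddCommGroup H]
    [InnerProductSpace ℂ H] [TopologicalSpace.SeparableSpace H] {v : ι → H}
    (hv : Orthonormal ℂ v) : Countable ι := by
  refine Pairwise.countable_of_isOpen_disjoint (s := fun i => Metric.ball (v i) (1 / 2))
    (fun i j hij => Metric.ball_disjoint_ball ?_) (fun _ => Metric.isOpen_ball)
    fun i => ⟨v i, Metric.mem_ball_self (by norm_num)⟩
  have h : ‖v i - v j‖ ^ 2 = 2 := by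
    rw [@norm_sub_sq ℂ, hv.1, hv.1, hv.2 hij]
    norm_num
  rw [dist_eq_norm]
  nlinarith [norm_nonneg (v i - v j)]

theorem nonempty_linearIsometryEquiv_l2 {H : Type*} [NormedAddCommGroup H]
    [InnerProductSpace ℂ H] [CompleteSpace H] [TopologicalSpace.SeparableSpace H]
    (hinf : ¬ FiniteDimensional ℂ H) : Nonempty (H ≃ₗᵢ[ℂ] lp (fun _ : ℕ => ℂ) 2) := by
  obtain ⟨w, b, -⟩ := exists_hilbertBasis ℂ H
  have : Countable w := b.orthonormal.countable_of_separable
  have : Infinite w := by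
    by_contra h
    have : Finite w := not_infinite_iff_finite.1 h
    have := Fintype.ofFinite w
    exact hinf (b.toOrthonormalBasis.toBasis.finiteDimensional_of_finite)
  obtain ⟨e⟩ := nonempty_equiv_of_countable (α := ℕ) (β := w)
  refine ⟨(HilbertBasis.mk (v := b ∘ e) (b.orthonormal.comp e e.injective) ?_).repr⟩
  rw [Set.range_comp, e.range_eq_univ, Set.image_univ, b.dense_span]

/-- A `*`-homomorphism that is isometric on the `*`-algebra generated by a set restricts to an
isomorphism of the generated `C*`-algebras. -/
theorem StarAlgHom.exists_equiv_closure_adjoin {B B' : Type*} [CStarAlgebra B] [CStarAlgebra B']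
    (π : B →⋆ₐ[ℂ] B') {s : Set B} {s' : Set B'} (hs : π '' s = s')
    (hπ : ∀ y ∈ StarAlgebra.adjoin ℂ s, ‖π y‖ = ‖y‖) {S : StarSubalgebra ℂ B}
    {S' : StarSubalgebra ℂ B'} (hS : S = (StarAlgebra.adjoin ℂ s).topologicalClosure)
    (hS' : S' = (StarAlgebra.adjoin ℂ s').topologicalClosure) :
    ∃ φ : S ≃⋆ₐ[ℂ] S', ∀ y, (φ y : B') = π y := by
  subst hs hS hS'
  have hc : Continuous π := AddMonoidHomClass.continuous_of_bound π 1 fun x => by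
    simpa using NonUnitalStarAlgHom.norm_apply_le π x
  have hiso : ∀ y ∈ (StarAlgebra.adjoin ℂ s).topologicalClosure, ‖π y‖ = ‖y‖ := fun y hy =>
    closure_minimal (s := (StarAlgebra.adjoin ℂ s : Set B)) (t := {y | ‖π y‖ = ‖y‖}) hπ
      (isClosed_eq hc.norm continuous_norm) hy
  have hmap : ∀ y ∈ StarAlgebra.adjoin ℂ s, π y ∈ StarAlgebra.adjoin ℂ (π '' s) := fun y hy => by
    rw [← StarAlgHom.map_adjoin]
    exact ⟨y, hy, rfl⟩
  have hmem : ∀ y : (StarAlgebra.adjoin ℂ s).topologicalClosure,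
      π y ∈ (StarAlgebra.adjoin ℂ (π '' s)).topologicalClosure := fun y =>
    map_mem_closure hc y.2 hmap
  let f := (π.comp (StarAlgebra.adjoin ℂ s).topologicalClosure.subtype).codRestrict
    (StarAlgebra.adjoin ℂ (π '' s)).topologicalClosure hmem
  have hf : Isometry f := AddMonoidHomClass.isometry_of_norm f fun y => hiso y y.2
  refine ⟨StarAlgEquiv.ofBijective f ⟨hf.injective, ?_⟩, fun y => rfl⟩
  -- the image is complete, hence closed
  have hcl : IsClosed ((fun y => (f y : B')) '' Set.univ) := by
    have : CompleteSpace (StarAlgebra.adjoin ℂ s).topologicalClosure :=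
      (StarSubalgebra.isClosed_topologicalClosure _).completeSpace_coe
    rw [Set.image_univ]
    exact (isometry_subtype_coe.comp hf).isClosedEmbedding.isClosed_range
  rintro ⟨z, hz⟩
  have hsub : (StarAlgebra.adjoin ℂ (π '' s) : Set B') ⊆ (fun y => (f y : B')) '' Set.univ := by
    intro w hw
    rw [← StarAlgHom.map_adjoin] at hw
    obtain ⟨y, hy, rfl⟩ := hw
    exact ⟨⟨y, StarSubalgebra.le_topologicalClosure _ hy⟩, Set.mem_univ _, rfl⟩
  obtain ⟨y, -, hy⟩ := closure_minimal hsub hcl hz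
  exact ⟨y, Subtype.ext hy⟩

/-- Evaluation of the elements of the universal algebra in a Cuntz–Krieger family. -/
noncomputable def evalCKRep {I H : Type*} [Fintype I] [NormedAddCommGroup H] [InnerProductSpace ℂ H]
    [CompleteSpace H] {A : Matrix I I ℤ} (T : CKRep H A) : CKProduct H A →⋆ₐ[ℂ] (H →L[ℂ] H) where
  toFun f := f T
  map_one' := rfl
  map_mul' _ _ := rfl
  map_zero' := rfl
  map_add' _ _ := rfl
  commutes' _ := rfl
  map_star' _ := rfl

/-- A Cuntz–Krieger family on a Hilbert space isomorphic to `K` generates a copy of the algebra of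
the universal family over `K`: conjugation turns it into one of the families on `K`, at which the
elements of the universal algebra can be evaluated. -/
theorem IsCuntzKriegerFamily.exists_ckAlgebra_equiv {I K H : Type*} [Fintype I] [DecidableEq I]
    [NormedAddCommGroup K] [InnerProductSpace ℂ K] [CompleteSpace K]
    [NormedAddCommGroup H] [InnerProductSpace ℂ H] [CompleteSpace H] [Nontrivial H]
    {A : Matrix I I ℤ} {T : I → (H →L[ℂ] H)}
    (hT : IsCuntzKriegerFamily A T) (hirr : A.IsIrreducible)
    (hA : ∀ i j, A i j = 0 ∨ A i j = 1) (hperm : ∀ σ : Equiv.Perm I, A ≠ σ.permMatrix ℤ)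
    (U : H ≃ₗᵢ[ℂ] K) {S : StarSubalgebra ℂ (H →L[ℂ] H)}
    (hS : S = (StarAlgebra.adjoin ℂ (Set.range T)).topologicalClosure) :
    ∃ φ : ckAlgebra K A ≃⋆ₐ[ℂ] S,
      ∀ i, (φ ⟨ckGenerator K A i, ckGenerator_mem K A i⟩ : H →L[ℂ] H) = T i := by
  let c : (H →L[ℂ] H) ≃⋆ₐ[ℂ] (K →L[ℂ] K) := U.conjStarAlgEquiv
  let T' : CKRep K A := ⟨fun i => c (T i), hT.map c.toStarAlgHom⟩
  let π : CKProduct K A →⋆ₐ[ℂ] (H →L[ℂ] H) := c.symm.toStarAlgHom.comp (evalCKRep T')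
  have hπ (i : I) : π (ckGenerator K A i) = T i := c.symm_apply_apply (T i)
  have hne (i : I) : π (ckGenerator K A i) ≠ 0 := fun h0 =>
    hT.ne_zero hirr hA i ((hπ i).symm.trans h0)
  have h1 : π '' Set.range (ckGenerator K A) = Set.range T := by
    rw [← Set.range_comp]
    exact congrArg Set.range (funext hπ)
  have h2 : ∀ y ∈ StarAlgebra.adjoin ℂ (Set.range (ckGenerator K A)), ‖π y‖ = ‖y‖ := fun y hy =>
    (isCuntzKriegerFamily_ckGenerator K A).norm_map_of_mem_adjoin hA
      (IsCuntzKriegerFamily.conditionI hirr hA hperm) hne hy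
  have h3 : ∃ φ : ckAlgebra K A ≃⋆ₐ[ℂ] S, ∀ y, (φ y : H →L[ℂ] H) = π y :=
    π.exists_equiv_closure_adjoin h1 h2 rfl hS
  obtain ⟨φ, hφ⟩ := h3
  exact ⟨φ, fun i => (hφ _).trans (hπ i)⟩

set_option maxHeartbeats 1000000 in
theorem theorem3p4 {Ω : Type*} [TopologicalSpace Ω] [PolishSpace Ω] [MeasurableSpace Ω]
    [BorelSpace Ω] (m : Measure Ω) [IsFiniteMeasure m] (hm : m ≠ 0)
    {I : Type*} [Fintype I] [DecidableEq I] (X : MarkovFibredSystem Ω m I)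
    (hcont : X.HasContinuousDensity)
    (hirr : X.incidence.IsIrreducible)
    (hperm : ∀ σ : Equiv.Perm I, X.incidence ≠ σ.permMatrix ℤ) :
    (∀ (i : I) (f : Lp ℂ 2 m), X.s i f =ᵐ[m] (X.a i).indicator
      fun x => (√(X.density x).toReal : ℂ) * f (X.θ x)) ∧
    ∃ φ : CuntzKriegerAlgebra X.incidence ≃⋆ₐ[ℂ] X.RNRep,
      ∀ i, (φ (CuntzKriegerAlgebra.S X.incidence i) : Lp ℂ 2 m →L[ℂ] Lp ℂ 2 m) = X.s i := by
  refine ⟨X.s_apply, ?_⟩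
  have hA := X.incidence_eq_zero_or_one
  have hs := X.isCuntzKriegerFamily_s
  have : Nontrivial (Lp ℂ 2 m) := by
    refine nontrivial_of_ne (indicatorConstLp 2 MeasurableSet.univ (measure_ne_top m _) (1 : ℂ)) 0
      fun h => ?_
    have hn := norm_indicatorConstLp (p := 2) (hs := MeasurableSet.univ)
      (hμs := measure_ne_top m Set.univ) (c := (1 : ℂ)) two_ne_zero ENNReal.ofNat_ne_top
    rw [h, norm_zero, norm_one, one_mul, eq_comm, Real.rpow_eq_zero measureReal_nonneg (by simp),
      measureReal_eq_zero_iff, Measure.measure_univ_eq_zero] at hn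
    exact hm hn
  have : Fact ((2 : ℝ≥0∞) ≠ ∞) := ⟨ENNReal.ofNat_ne_top⟩
  obtain ⟨U⟩ := nonempty_linearIsometryEquiv_l2 (hs.not_finiteDimensional hirr hA hperm)
  exact hs.exists_ckAlgebra_equiv hirr hA hperm U rfl
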